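/- **Setting.** Consider the Hammerstein system $$y_{k+1}=a_1y_k+\cdots+a_py_{k+1-p}+b_1f(u_k)+\cdots+b_qf(u_{k+1-q})+w_{k+1},\qquad f(u)=\sum_{j=1}^s d_jg_j(u),$$ with measurable basis functions $g_j:\mathbb R\to\mathbb R$ and arbitrary initial values. Let $r=p+qs$, $$\varphi_k=[y_k\dots y_{k+1-p}\ g_1(u_k)\dots g_s(u_k)\ \dots\ g_1(u_{k+1-q})\dots g_s(u_{k+1-q})]^T\in\mathbb R^{r},$$ so that $y_{k+1}=\theta^T\varphi_k+w_{k+1}$ with $\theta=[a_1\dots a_p\ (b_1d_1)\dots(b_1d_s)\ \dots\ (b_qd_1)\dots(b_qd_s)]^T$. Let $\{\mathcal F_k\}$ be a filtration such that $y_j,u_j,w_j$ are $\mathcal F_k$-measurable for $j\le k$. **Algorithm.** Let $\lambda_{\max}(N),\lambda_{\min}(N)$ be the extreme eigenvalues of $\sum_{k=1}^N\varphi_k\varphi_k^T$, let $\theta_{N+1}=\big(\sum_{k=1}^N\varphi_k\varphi_k^T\big)^{-1}\sum_{k=1}^N\varphi_ky_{k+1}$, and $$\widehat\theta_{N+1}(l)=\theta_{N+1}(l)+\mathrm{sgn}(\theta_{N+1}(l))\sqrt{\frac{\log\lambda_{\max}(N)}{\lambda_{\min}(N)}},\qquad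 \mathrm{sgn}(x)=1\ (x\ge 0),\ \ -1\ (x<0).$$ Let $\beta_{N+1}$ be the minimiser over $\beta\in\mathbb R^r$ of $$J_{N+1}(\beta)=\sum_{k=1}^N(y_{k+1}-\beta^T\varphi_k)^2+\lambda_N\sum_{l=1}^r\frac{|\beta(l)|}{|\widehat\theta_{N+1}(l)|}.$$ Write $(b_id_l)_{N+1}$ for the entry of $\beta_{N+1}$ in the position of $b_id_l$, and set $$B^*=\{l: d_l=0\},\qquad B^*_{N+1}=\{l:(b_1d_l)_{N+1}=\cdots=(b_qd_l)_{N+1}=0\}.$$ **Assumptions.** 1. $\mathbb E[w_{k+1}\mid\mathcal F_k]=0$ for $k\ge1$, and $\sup_{k\ge 1}\mathbb E[|w_{k+1}|^\gamma\mid\mathcal F_k]<\infty$ a.s. for some $\gamma>2$. 2. $A(z)=1-a_1z-\cdots-a_pz^p\ne0$ for all complex $|z|\le1$, and $b_1^2+\cdots+b_q^2\neq0$. 3. $1,g_1,\dots,g_s$ are linearly independent over some interval $[x_0,x_1]$, $x_0<x_1$, functions equal Lebesgue-almost everywhere on $[x_0,x_1]$ being identified. 4. $\{u_k\}_{k\ge1}$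 is i.i.d. with a density that is positive and continuous on $[x_0,x_1]$, $0<\mathbb E g_i(u_k)^2<\infty$ for $i=1,\dots,s$, and the sequences $\{u_k\}_{k\ge1}$ and $\{w_k\}_{k\ge1}$ are independent. 5. (Nondegeneracy.) Either $\liminf_{N\to\infty}\frac1N\sum_{k=1}^Nw_k^2>0$ a.s., or else $A(z)$ and $B(z)=b_1+b_2z+\cdots+b_qz^{q-1}$ are coprime, the coefficient of $z^p$ in $A(z)$ or the coefficient $b_q$ is nonzero, and $(d_1,\dots,d_s)\ne0$. **Proposition 2.** Let $\lambda_N=N^{\frac12+\epsilon}$ with fixed $\epsilon\in(0,\frac12)$. Under these assumptions there is a set $\Omega_0$ with $\mathbb P(\Omega_0)=1$ such that for every $\omega\in\Omega_0$ there is an integer $N_0(\omega)$ such that for all $N\ge N_0(\omega)$ the algorithm is well defined (the matrix $\sum_{k=1}^N\varphi_k\varphi_k^T$ is invertible, $\widehat\theta_{N+1}(l)\ne0$ for all $l$, and $J_{N+1}$ has exactly one minimiser) and $$B^*_{N+1}=B^*.$$ -/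

import Mathlib

open MeasureTheory ProbabilityTheory Filter Matrix

/-! ### The sparse identification algorithm for a linear regression

`φ k` is the regressor at time `k`, `z k` the output paired with it (the output at time `k + 1`);
the data available at step `N` are `(φ k, z k)` for `k = 1, …, N`. -/

section Algorithm

variable {ι : Type*}

/-- The information matrix `∑_{k=1}^N φ_k φ_kᵀ`. -/
def gramMatrix (φ : ℕ → ι → ℝ) (N : ℕ) : Matrix ι ι ℝ :=
  ∑ k ∈ Finset.Icc 1 N, vecMulVec (φ k) (φ k)

theorem gramMatrix_isHermitian (φ : ℕ → ι → ℝ) (N : ℕ) : (gramMatrix φ N).IsHermitian := by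
  ext i j
  simp [gramMatrix, Matrix.sum_apply, vecMulVec_apply, mul_comm]

variable [Fintype ι] [DecidableEq ι]

/-- `λ_max(N)`, the largest eigenvalue of the information matrix. -/
noncomputable def lamMax (φ : ℕ → ι → ℝ) (N : ℕ) : ℝ :=
  ⨆ i, (gramMatrix_isHermitian φ N).eigenvalues i

/-- `λ_min(N)`, the smallest eigenvalue of the information matrix. -/
noncomputable def lamMin (φ : ℕ → ι → ℝ) (N : ℕ) : ℝ :=
  ⨅ i, (gramMatrix_isHermitian φ N).eigenvalues i

/-- The least-squares estimate `(∑ φ_k φ_kᵀ)⁻¹ ∑ φ_k y_{k+1}` from the data `k = 1, …, N`. -/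
noncomputable def lsEstimate (φ : ℕ → ι → ℝ) (z : ℕ → ℝ) (N : ℕ) : ι → ℝ :=
  (gramMatrix φ N)⁻¹ *ᵥ ∑ k ∈ Finset.Icc 1 N, z k • φ k

/-- The sign convention `sgn x = 1` for `x ≥ 0` and `sgn x = -1` for `x < 0`. -/
noncomputable def sgnPlus (x : ℝ) : ℝ := if 0 ≤ x then 1 else -1

/-- The modified least-squares estimate
`θ(j) + sgn(θ(j)) √(log λ_max(N) / λ_min(N))`. -/
noncomputable def modifiedEstimate (φ : ℕ → ι → ℝ) (z : ℕ → ℝ) (N : ℕ) (j : ι) : ℝ :=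
  lsEstimate φ z N j +
    sgnPlus (lsEstimate φ z N j) * Real.sqrt (Real.log (lamMax φ N) / lamMin φ N)

/-- The convex criterion
`∑_{k=1}^N (y_{k+1} - βᵀ φ_k)² + λ_N ∑_l |β(l)| / |modified estimate (l)|`. -/
noncomputable def sparseCriterion (φ : ℕ → ι → ℝ) (z : ℕ → ℝ) (lam : ℕ → ℝ) (N : ℕ)
    (β : ι → ℝ) : ℝ :=
  ∑ k ∈ Finset.Icc 1 N, (z k - β ⬝ᵥ φ k) ^ 2 +
    lam N * ∑ l, 1 / |modifiedEstimate φ z N l| * |β l|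

/-- `β` is a (global) minimiser of the convex criterion. -/
def IsSparseEstimate (φ : ℕ → ι → ℝ) (z : ℕ → ℝ) (lam : ℕ → ℝ) (N : ℕ) (β : ι → ℝ) : Prop :=
  ∀ β' : ι → ℝ, sparseCriterion φ z lam N β ≤ sparseCriterion φ z lam N β'

/-- The algorithm is well defined at step `N`: the information matrix is invertible, no weight in
the criterion has a vanishing denominator, and the criterion has exactly one minimiser. -/
def SparseAlgorithmWellDefined (φ : ℕ → ι → ℝ) (z : ℕ → ℝ) (lam : ℕ → ℝ) (N : ℕ) : Prop :=
  IsUnit (gramMatrix φ N).det ∧ (∀ l, modifiedEstimate φ z N l ≠ 0) ∧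
    ∃! β : ι → ℝ, IsSparseEstimate φ z lam N β

end Algorithm

/-! ### Hammerstein systems -/

section Hammerstein

variable {p q s : ℕ}

/-- `A(z) = 1 - a_1 z - ⋯ - a_p z^p`. -/
noncomputable def arPoly (a : Fin p → ℝ) : Polynomial ℝ :=
  1 - ∑ i : Fin p, Polynomial.C (a i) * Polynomial.X ^ ((i : ℕ) + 1)

/-- `B(z) = b_1 + b_2 z + ⋯ + b_q z^(q-1)`. -/
noncomputable def inputPoly (b : Fin q → ℝ) : Polynomial ℝ :=
  ∑ i : Fin q, Polynomial.C (b i) * Polynomial.X ^ (i : ℕ)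

/-- The Hammerstein equations, along one sample path:
`y_{k+1} = a_1 y_k + ⋯ + a_p y_{k+1-p} + b_1 f(u_k) + ⋯ + b_q f(u_{k+1-q}) + w_{k+1}` for `k ≥ 1`,
with `f = ∑_j d_j g_j`. The values `y_j`, `u_j` at times `j` that precede the equations
are arbitrary initial values. -/
def IsHammersteinPath (a : Fin p → ℝ) (b : Fin q → ℝ) (d : Fin s → ℝ) (g : Fin s → ℝ → ℝ)
    (y u : ℤ → ℝ) (w : ℕ → ℝ) : Prop :=
  ∀ k : ℕ, 1 ≤ k →
    y ((k : ℤ) + 1) = ∑ i : Fin p, a i * y ((k : ℤ) - (i : ℤ))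
      + ∑ i : Fin q, b i * ∑ j : Fin s, d j * g j (u ((k : ℤ) - (i : ℤ))) + w (k + 1)

/-- The over-parametrised regressor
`[y_k, …, y_{k+1-p}, g_1(u_k), …, g_s(u_k), …, g_1(u_{k+1-q}), …, g_s(u_{k+1-q})]`:
the entry `inl i` goes with `a_i`, the entry `inr (i, j)` with the product `b_i d_j`. -/
def hammersteinRegressor (p q : ℕ) (g : Fin s → ℝ → ℝ) (y u : ℤ → ℝ) (k : ℕ) :
    Fin p ⊕ (Fin q × Fin s) → ℝ :=
  Sum.elim (fun i => y ((k : ℤ) - (i : ℤ))) (fun ij => g ij.2 (u ((k : ℤ) - (ij.1 : ℤ))))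

/-- The output `y_{k+1}` paired with the regressor at time `k`. -/
def nextOutput (y : ℤ → ℝ) (k : ℕ) : ℝ := y ((k : ℤ) + 1)

/-- The indices `l` for which the column `[(b_1 d_l), …, (b_q d_l)]ᵀ` of an over-parametrised
parameter vector vanishes. -/
def zeroColumns (β : Fin p ⊕ (Fin q × Fin s) → ℝ) : Set (Fin s) :=
  {l | ∀ i : Fin q, β (Sum.inr (i, l)) = 0}

/-- `A` is stable (no zero in the closed unit disc) and `b_1² + ⋯ + b_q² ≠ 0`. -/
def StableARX (a : Fin p → ℝ) (b : Fin q → ℝ) : Prop :=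
  (∀ z : ℂ, ‖z‖ ≤ 1 → Polynomial.aeval z (arPoly a) ≠ 0) ∧ ∑ i, b i ^ 2 ≠ 0

/-- `1, g_1, …, g_s` are linearly independent over `[lo, hi]`, functions that agree
Lebesgue-almost everywhere being identified. For functions that are continuous on `[lo, hi]`,
`lo < hi`, this is linear independence on `[lo, hi]`. -/
def BasisIndependentOn (g : Fin s → ℝ → ℝ) (lo hi : ℝ) : Prop :=
  ∀ (c₀ : ℝ) (c : Fin s → ℝ),
    (∀ᵐ x ∂(volume.restrict (Set.Icc lo hi)), c₀ + ∑ j, c j * g j x = 0) → c₀ = 0 ∧ c = 0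

variable {Ω : Type*} {mΩ : MeasurableSpace Ω}

/-- `{w_k, ℱ_k}` is a martingale difference sequence, `E[w_{k+1} | ℱ_k] = 0` for `k ≥ 1`, and
`sup_k E[|w_{k+1}|^γ | ℱ_k] < ∞` almost surely for some `γ > 2`. -/
def MartingaleDifferenceNoise (P : Measure Ω) (ℱ : Filtration ℕ mΩ) (w : ℕ → Ω → ℝ) : Prop :=
  (∀ k, 1 ≤ k → Measurable[ℱ k] (w k)) ∧
  (∀ k, 1 ≤ k → Integrable (w (k + 1)) P ∧ P[w (k + 1) | ℱ k] =ᵐ[P] 0) ∧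
  ∃ γ : ℝ, 2 < γ ∧ ∀ᵐ ω ∂P,
    ⨆ k : ℕ, ⨆ _ : 1 ≤ k,
      condLExp (ℱ k) P (fun ω' => ENNReal.ofReal (|w (k + 1) ω'| ^ γ)) ω < ⊤

/-- `{u_k}_{k ≥ 1}` is i.i.d. with a density that is positive and continuous on `[lo, hi]`,
`0 < E g_i(u_k)² < ∞` for all `i`, and `{u_k}_{k ≥ 1}` is independent of `{w_k}_{k ≥ 1}`. -/
def IIDInput (P : Measure Ω) (g : Fin s → ℝ → ℝ) (lo hi : ℝ) (u : ℤ → Ω → ℝ)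
    (w : ℕ → Ω → ℝ) : Prop :=
  iIndepFun (fun (k : ℕ) ω => u ((k : ℤ) + 1) ω) P ∧
  (∃ dens : ℝ → ℝ, Measurable dens ∧ (∀ x, 0 ≤ dens x) ∧ ContinuousOn dens (Set.Icc lo hi) ∧
    (∀ x ∈ Set.Icc lo hi, 0 < dens x) ∧
    ∀ k : ℤ, 1 ≤ k →
      P.map (u k) = volume.withDensity (fun x => ENNReal.ofReal (dens x))) ∧
  (∀ i, ∀ k : ℤ, 1 ≤ k →
    Integrable (fun ω => g i (u k ω) ^ 2) P ∧ 0 < ∫ ω, g i (u k ω) ^ 2 ∂P) ∧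
  IndepFun (fun ω (k : ℕ) => u ((k : ℤ) + 1) ω) (fun ω (k : ℕ) => w (k + 1) ω) P

/-- The noise does not die out: almost surely `liminf (1/N) ∑_{k=1}^N w_k² > 0`. -/
def PersistentNoise (P : Measure Ω) (w : ℕ → Ω → ℝ) : Prop :=
  ∀ᵐ ω ∂P, ∃ c : ℝ, 0 < c ∧ ∀ᶠ N : ℕ in atTop, c * N ≤ ∑ k ∈ Finset.Icc 1 N, w k ω ^ 2

/-- The noise-free part of the system has no redundancy: `A` and `B` have no common factor,
`a_p ≠ 0` or `b_q ≠ 0`, and `f` is not the zero combination. For `p = 0` the second condition holds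
automatically, since the coefficient of degree `0` of `A` is `1`. -/
def MinimalSystem (a : Fin p → ℝ) (b : Fin q → ℝ) (d : Fin s → ℝ) : Prop :=
  IsCoprime (arPoly a) (inputPoly b) ∧
    ((arPoly a).coeff p ≠ 0 ∨ (Polynomial.X * inputPoly b).coeff q ≠ 0) ∧ d ≠ 0

end Hammerstein

/-! ### Deterministic analysis of weighted least squares along one path -/

section SparseLeastSquares

variable {ι : Type*} [Fintype ι]

/-! The proof splits into a deterministic part, valid along one sample path, and almost sure
estimates that put almost every path in its scope.

Deterministic part (`eventually_sparseEstimate_eq_zero_iff`): suppose the information matrix is at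
least `c N`, its trace is O(N^(9/8)) and `∑ φ_k w_{k+1}` is O(N^(9/16)). Then the least-squares
error is O(N^(-7/16)), so the penalty weights stay bounded at nonzero entries of `θ` and are at
least of order N^(3/8) at zero entries, up to which size the logarithmic correction is absorbed. At
nonzero entries the penalty adds a bias of order λ_N / N, which tends to 0, so these entries stay
nonzero. At zero entries the penalty slope is at least of order N^(7/8+ε), while the squared loss
can resist with O(N^(3/4+ε)) only; hence the entry is exactly zero.

Upper bounds: sums of a martingale difference against a predictable factor are controlled by L²
martingale convergence after truncation (`IsBoundedVarianceMDS.ae_bounded_sum`) and Abel summation.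
Everything is measured by `WeightedSqSummable`, a class that contains noise and transformed inputs
and that the stable filter 1/A preserves (`weightedSqSummable_of_aeval_backshift`).

Lower bound (`IsHammersteinPath.exists_excitation`): applying `A` to `xᵀφ_k` gives a finite moving
average of the noise and the `g_j(u)`, and this filter is bounded, so it is enough to excite the
filtered regressor. In its empirical second moments the cross terms vanish. What remains is a
quadratic form built from the noise energy and the covariance of the `g_j(u)`. It is positive
definite because the covariance is (linear independence with 1) and because no direction `x` is
invisible: either the noise persists, or coprimeness excludes cancellation. -/

theorem gramMatrix_mulVec (φ : ℕ → ι → ℝ) (N : ℕ) (x : ι → ℝ) :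
    gramMatrix φ N *ᵥ x = ∑ k ∈ Finset.Icc 1 N, (x ⬝ᵥ φ k) • φ k := by
  rw [gramMatrix, Matrix.sum_mulVec]
  refine Finset.sum_congr rfl fun k _ => ?_
  ext i
  simp [vecMulVec_mulVec, dotProduct_comm, mul_comm]

theorem dotProduct_gramMatrix_mulVec (φ : ℕ → ι → ℝ) (N : ℕ) (x x' : ι → ℝ) :
    x' ⬝ᵥ (gramMatrix φ N *ᵥ x) = ∑ k ∈ Finset.Icc 1 N, (x ⬝ᵥ φ k) * (x' ⬝ᵥ φ k) := by
  rw [gramMatrix_mulVec, dotProduct_sum]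
  simp [dotProduct_smul]

theorem trace_gramMatrix (φ : ℕ → ι → ℝ) (N : ℕ) :
    (gramMatrix φ N).trace = ∑ k ∈ Finset.Icc 1 N, ∑ l, φ k l ^ 2 := by
  simp [gramMatrix, Matrix.trace, Matrix.sum_apply, vecMulVec_apply, pow_two]
  rw [Finset.sum_comm]

theorem sq_sum_abs_le (x : ι → ℝ) : (∑ l, |x l|) ^ 2 ≤ Fintype.card ι * ∑ l, x l ^ 2 := by
  have := sq_sum_le_card_mul_sum_sq (s := Finset.univ) (f := fun l => |x l|)
  simpa using this

theorem dotProduct_le_mul_sum_abs (x v : ι → ℝ) {V : ℝ} (hv : ∀ l, |v l| ≤ V) :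
    |x ⬝ᵥ v| ≤ V * ∑ l, |x l| := by
  rw [dotProduct, Finset.mul_sum]
  refine (Finset.abs_sum_le_sum_abs _ _).trans (Finset.sum_le_sum fun l _ => ?_)
  rw [abs_mul, mul_comm]
  exact mul_le_mul_of_nonneg_right (hv l) (abs_nonneg _)

/-- If `κ |x|² ≤ K |x|₁` then `|x|₁ ≤ card ι * K / κ`. -/
theorem sum_abs_le_of_sum_sq_le {κ K : ℝ} (hκ : 0 < κ) (hK : 0 ≤ K) (x : ι → ℝ)
    (h : κ * ∑ l, x l ^ 2 ≤ K * ∑ l, |x l|) :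
    ∑ l, |x l| ≤ Fintype.card ι * K / κ := by
  have h0 : 0 ≤ ∑ l, |x l| := Finset.sum_nonneg fun l _ => abs_nonneg _
  have h1 := sq_sum_abs_le x
  rcases h0.eq_or_lt with h2 | h2
  · rw [← h2]; positivity
  · rw [le_div_iff₀ hκ]
    have h3 : κ * (∑ l, |x l|) ^ 2 ≤ Fintype.card ι * (K * ∑ l, |x l|) := by
      calc κ * (∑ l, |x l|) ^ 2 ≤ κ * (Fintype.card ι * ∑ l, x l ^ 2) := by gcongr
        _ = Fintype.card ι * (κ * ∑ l, x l ^ 2) := by ring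
        _ ≤ _ := by gcongr
    nlinarith

section Excited

variable {φ : ℕ → ι → ℝ} {N : ℕ} {κ : ℝ}

theorem posDef_gramMatrix (hκ : 0 < κ)
    (h : ∀ x : ι → ℝ, κ * ∑ l, x l ^ 2 ≤ ∑ k ∈ Finset.Icc 1 N, (x ⬝ᵥ φ k) ^ 2) :
    (gramMatrix φ N).PosDef := by
  refine Matrix.PosDef.of_dotProduct_mulVec_pos (gramMatrix_isHermitian φ N) fun x hx => ?_
  have h1 := h x
  have : star x ⬝ᵥ (gramMatrix φ N *ᵥ x) = ∑ k ∈ Finset.Icc 1 N, (x ⬝ᵥ φ k) ^ 2 := by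
    rw [star_trivial, dotProduct_gramMatrix_mulVec]
    simp [pow_two]
  rw [this]
  refine lt_of_lt_of_le (mul_pos hκ ?_) h1
  obtain ⟨l, hl⟩ := Function.ne_iff.1 hx
  exact Finset.sum_pos' (fun _ _ => sq_nonneg _) ⟨l, Finset.mem_univ _, by
    have : x l ≠ 0 := hl
    positivity⟩

variable [DecidableEq ι]

theorem le_eigenvalues_gramMatrix
    (h : ∀ x : ι → ℝ, κ * ∑ l, x l ^ 2 ≤ ∑ k ∈ Finset.Icc 1 N, (x ⬝ᵥ φ k) ^ 2) (i : ι) :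
    κ ≤ (gramMatrix_isHermitian φ N).eigenvalues i := by
  rw [Matrix.IsHermitian.eigenvalues_eq]
  set v := (gramMatrix_isHermitian φ N).eigenvectorBasis i with hv
  have h1 : ∑ l, v l ^ 2 = 1 := by
    have := (gramMatrix_isHermitian φ N).eigenvectorBasis.orthonormal.1 i
    rw [← hv, EuclideanSpace.norm_eq, Real.sqrt_eq_one] at this
    simpa using this
  have h2 := h v
  rw [h1, mul_one] at h2
  rw [star_trivial, dotProduct_gramMatrix_mulVec]
  simpa [pow_two] using h2

theorem le_lamMin [Nonempty ι]
    (h : ∀ x : ι → ℝ, κ * ∑ l, x l ^ 2 ≤ ∑ k ∈ Finset.Icc 1 N, (x ⬝ᵥ φ k) ^ 2) :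
    κ ≤ lamMin φ N :=
  le_ciInf fun i => le_eigenvalues_gramMatrix h i

theorem lamMin_le_lamMax [Nonempty ι] : lamMin φ N ≤ lamMax φ N := by
  let i : ι := Classical.arbitrary ι
  exact (ciInf_le (Set.finite_range _).bddBelow i).trans (le_ciSup (Set.finite_range _).bddAbove i)

/-- The eigenvalues are nonnegative, so the largest is at most the trace. -/
theorem lamMax_le [Nonempty ι] : lamMax φ N ≤ ∑ k ∈ Finset.Icc 1 N, ∑ l, φ k l ^ 2 := by
  refine ciSup_le fun i => ?_
  have h0 : ∀ i, 0 ≤ (gramMatrix_isHermitian φ N).eigenvalues i := fun i =>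
    le_eigenvalues_gramMatrix (κ := 0) (fun x => by
      rw [zero_mul]; exact Finset.sum_nonneg fun _ _ => sq_nonneg _) i
  rw [← trace_gramMatrix, (gramMatrix_isHermitian φ N).trace_eq_sum_eigenvalues]
  simpa using Finset.single_le_sum (fun j _ => h0 j) (Finset.mem_univ i)

/-- The normal equations say that the Gram matrix sends the error to `∑ φ_k ν_k`; pairing with the
error itself bounds its square by its ℓ¹ norm. -/
theorem sum_abs_lsEstimate_sub_le {z ν : ℕ → ℝ} {θ : ι → ℝ} {V : ℝ} (hκ : 0 < κ) (hV : 0 ≤ V)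
    (h : ∀ x : ι → ℝ, κ * ∑ l, x l ^ 2 ≤ ∑ k ∈ Finset.Icc 1 N, (x ⬝ᵥ φ k) ^ 2)
    (hz : ∀ k, 1 ≤ k → z k = θ ⬝ᵥ φ k + ν k)
    (hν : ∀ l, |∑ k ∈ Finset.Icc 1 N, φ k l * ν k| ≤ V) :
    ∑ l, |lsEstimate φ z N l - θ l| ≤ Fintype.card ι * V / κ := by
  have hdet : IsUnit (gramMatrix φ N).det := (posDef_gramMatrix hκ h).det_pos.ne'.isUnit
  set v : ι → ℝ := fun l => ∑ k ∈ Finset.Icc 1 N, φ k l * ν k with hv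
  have h1 : ∑ k ∈ Finset.Icc 1 N, z k • φ k = gramMatrix φ N *ᵥ θ + v := by
    rw [gramMatrix_mulVec]
    ext l
    simp only [Finset.sum_apply, Pi.add_apply, Pi.smul_apply, smul_eq_mul, hv,
      ← Finset.sum_add_distrib]
    refine Finset.sum_congr rfl fun k hk => ?_
    rw [hz k (Finset.mem_Icc.1 hk).1]; ring
  set x : ι → ℝ := lsEstimate φ z N - θ with hx
  have h2 : gramMatrix φ N *ᵥ x = v := by
    rw [hx, Matrix.mulVec_sub, lsEstimate, Matrix.mulVec_mulVec, Matrix.mul_nonsing_inv _ hdet,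
      Matrix.one_mulVec, h1]
    simp
  refine sum_abs_le_of_sum_sq_le hκ hV x ?_
  refine (h x).trans ?_
  have h3 := dotProduct_gramMatrix_mulVec φ N x x
  rw [h2] at h3
  simp only [← pow_two] at h3
  rw [← h3]
  exact (le_abs_self _).trans (dotProduct_le_mul_sum_abs x v hν)

theorem continuous_sparseCriterion (φ : ℕ → ι → ℝ) (z : ℕ → ℝ) (lam : ℕ → ℝ) (N : ℕ) :
    Continuous (sparseCriterion φ z lam N) := by
  unfold sparseCriterion dotProduct
  fun_prop

theorem sum_sq_le_sparseCriterion {z lam : ℕ → ℝ} (hlam : 0 ≤ lam N) (β : ι → ℝ) :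
    ∑ k ∈ Finset.Icc 1 N, (z k - β ⬝ᵥ φ k) ^ 2 ≤ sparseCriterion φ z lam N β := by
  unfold sparseCriterion
  have : 0 ≤ lam N * ∑ l, 1 / |modifiedEstimate φ z N l| * |β l| :=
    mul_nonneg hlam (Finset.sum_nonneg fun l _ => by positivity)
  linarith

/-- Excitation makes the criterion coercive: its sublevel set at the value of the zero vector is
bounded, and continuity on a ball gives a minimiser. -/
theorem exists_isSparseEstimate {z lam : ℕ → ℝ} (hlam : 0 ≤ lam N) (hκ : 0 < κ)
    (h : ∀ x : ι → ℝ, κ * ∑ l, x l ^ 2 ≤ ∑ k ∈ Finset.Icc 1 N, (x ⬝ᵥ φ k) ^ 2) :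
    ∃ β, IsSparseEstimate φ z lam N β := by
  set J := sparseCriterion φ z lam N with hJ
  have key : ∀ β, κ * ∑ l, β l ^ 2 ≤ 2 * ∑ k ∈ Finset.Icc 1 N, z k ^ 2 + 2 * J β := fun β => by
    refine (h β).trans ?_
    refine le_trans ?_ (add_le_add_right
      (mul_le_mul_of_nonneg_left (sum_sq_le_sparseCriterion hlam β) zero_le_two) _)
    rw [← mul_add, ← Finset.sum_add_distrib, Finset.mul_sum]
    exact Finset.sum_le_sum fun k _ => by nlinarith [sq_nonneg (2 * z k - β ⬝ᵥ φ k)]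
  set R := (2 * ∑ k ∈ Finset.Icc 1 N, z k ^ 2 + 2 * J 0) / κ with hR
  have key' : ∀ β, J β ≤ J 0 → ∑ l, β l ^ 2 ≤ R := fun β hβ => by
    rw [hR, le_div_iff₀ hκ]
    linarith [key β]
  have hR0 : 0 ≤ R := by simpa using key' 0 le_rfl
  have hK : IsCompact (Metric.closedBall (0 : ι → ℝ) (R + 1)) := isCompact_closedBall _ _
  obtain ⟨β, -, hβ⟩ := hK.exists_isMinOn ⟨0, by simp; linarith⟩
    (continuous_sparseCriterion φ z lam N).continuousOn
  refine ⟨β, fun β' => ?_⟩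
  have hβ0 : J β ≤ J 0 := hβ (by simp; linarith)
  by_cases h0 : J β' ≤ J 0
  · refine hβ ?_
    rw [mem_closedBall_zero_iff, pi_norm_le_iff_of_nonneg (by linarith)]
    intro l
    have h1 : β' l ^ 2 ≤ R :=
      (Finset.single_le_sum (fun l _ => sq_nonneg (β' l)) (Finset.mem_univ l)).trans (key' β' h0)
    rw [Real.norm_eq_abs]
    refine abs_le_of_sq_le_sq (h1.trans ?_) (by linarith)
    nlinarith
  · exact hβ0.trans (not_le.1 h0).le

/-- Strict convexity at the midpoint: the loss gains a quarter of `∑ ((β - β')ᵀφ_k)²` over the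
average, and excitation forces this gain to be positive unless `β = β'`. -/
theorem isSparseEstimate_unique {z lam : ℕ → ℝ} (hlam : 0 ≤ lam N) (hκ : 0 < κ)
    (h : ∀ x : ι → ℝ, κ * ∑ l, x l ^ 2 ≤ ∑ k ∈ Finset.Icc 1 N, (x ⬝ᵥ φ k) ^ 2)
    {β β' : ι → ℝ} (hβ : IsSparseEstimate φ z lam N β) (hβ' : IsSparseEstimate φ z lam N β') :
    β = β' := by
  set m : ι → ℝ := (1 / 2 : ℝ) • (β + β') with hm
  have h1 : ∑ k ∈ Finset.Icc 1 N, (z k - m ⬝ᵥ φ k) ^ 2 =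
      (∑ k ∈ Finset.Icc 1 N, (z k - β ⬝ᵥ φ k) ^ 2 +
        ∑ k ∈ Finset.Icc 1 N, (z k - β' ⬝ᵥ φ k) ^ 2) / 2 -
      (∑ k ∈ Finset.Icc 1 N, ((β - β') ⬝ᵥ φ k) ^ 2) / 4 := by
    rw [← Finset.sum_add_distrib, Finset.sum_div, Finset.sum_div, ← Finset.sum_sub_distrib]
    refine Finset.sum_congr rfl fun k _ => ?_
    rw [hm, smul_dotProduct, add_dotProduct, sub_dotProduct, smul_eq_mul]
    ring
  have h2 : ∑ l, 1 / |modifiedEstimate φ z N l| * |m l| ≤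
      (∑ l, 1 / |modifiedEstimate φ z N l| * |β l| +
        ∑ l, 1 / |modifiedEstimate φ z N l| * |β' l|) / 2 := by
    rw [← Finset.sum_add_distrib, Finset.sum_div]
    refine Finset.sum_le_sum fun l _ => ?_
    rw [← mul_add, mul_div_assoc]
    refine mul_le_mul_of_nonneg_left ?_ (by positivity)
    have : m l = (β l + β' l) / 2 := by simp [hm]; ring
    rw [this, abs_div, abs_two]
    gcongr
    exact abs_add_le _ _
  have h3 := mul_le_mul_of_nonneg_left h2 hlam
  have h4 := hβ m
  have h5 := hβ' m
  have h6 := h (β - β')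
  unfold sparseCriterion at h4 h5
  rw [h1] at h4 h5
  have h7 : κ * ∑ l, (β - β') l ^ 2 ≤ 0 := by linarith
  have h8 : ∑ l, (β - β') l ^ 2 = 0 :=
    le_antisymm (by nlinarith) (Finset.sum_nonneg fun _ _ => sq_nonneg _)
  rw [Finset.sum_eq_zero_iff_of_nonneg fun _ _ => sq_nonneg _] at h8
  funext l
  have := h8 l (Finset.mem_univ l)
  simpa [sub_eq_zero] using this

/-- The basic inequality of penalised regression, from comparing `β` with `θ`. Off the support of
`θ` the penalty difference has the favourable sign, so only weights on the support enter, and these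
are bounded by `W`. -/
theorem sum_abs_sparseEstimate_sub_le {z ν lam : ℕ → ℝ} {θ β : ι → ℝ} {V W : ℝ}
    (hlam : 0 ≤ lam N) (hκ : 0 < κ) (hV : 0 ≤ V) (hW : 0 ≤ W)
    (h : ∀ x : ι → ℝ, κ * ∑ l, x l ^ 2 ≤ ∑ k ∈ Finset.Icc 1 N, (x ⬝ᵥ φ k) ^ 2)
    (hz : ∀ k, 1 ≤ k → z k = θ ⬝ᵥ φ k + ν k)
    (hν : ∀ l, |∑ k ∈ Finset.Icc 1 N, φ k l * ν k| ≤ V)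
    (hw : ∀ l, θ l ≠ 0 → 1 / |modifiedEstimate φ z N l| ≤ W)
    (hβ : IsSparseEstimate φ z lam N β) :
    ∑ l, |β l - θ l| ≤ Fintype.card ι * (2 * V + lam N * W) / κ := by
  refine sum_abs_le_of_sum_sq_le (x := fun l => β l - θ l) hκ (by positivity) ?_
  refine (h _).trans ?_
  change ∑ k ∈ Finset.Icc 1 N, ((β - θ) ⬝ᵥ φ k) ^ 2 ≤ _
  have h1 := hβ θ
  unfold sparseCriterion at h1
  have h2 : ∑ k ∈ Finset.Icc 1 N, (z k - β ⬝ᵥ φ k) ^ 2 =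
      ∑ k ∈ Finset.Icc 1 N, (z k - θ ⬝ᵥ φ k) ^ 2 + ∑ k ∈ Finset.Icc 1 N, ((β - θ) ⬝ᵥ φ k) ^ 2
        - 2 * ∑ k ∈ Finset.Icc 1 N, (β - θ) ⬝ᵥ φ k * ν k := by
    rw [Finset.mul_sum, ← Finset.sum_add_distrib, ← Finset.sum_sub_distrib]
    refine Finset.sum_congr rfl fun k hk => ?_
    rw [hz k (Finset.mem_Icc.1 hk).1, sub_dotProduct]
    ring
  have h3 : ∑ k ∈ Finset.Icc 1 N, (β - θ) ⬝ᵥ φ k * ν k ≤ V * ∑ l, |β l - θ l| := by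
    have e : ∑ k ∈ Finset.Icc 1 N, (β - θ) ⬝ᵥ φ k * ν k =
        (β - θ) ⬝ᵥ fun l => ∑ k ∈ Finset.Icc 1 N, φ k l * ν k := by
      simp only [dotProduct, Finset.mul_sum, Finset.sum_mul]
      rw [Finset.sum_comm]
      simp only [mul_assoc]
    rw [e]
    exact (le_abs_self _).trans (dotProduct_le_mul_sum_abs _ _ hν)
  have h4 : ∑ l, 1 / |modifiedEstimate φ z N l| * |θ l| -
      ∑ l, 1 / |modifiedEstimate φ z N l| * |β l| ≤ W * ∑ l, |β l - θ l| := by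
    rw [← Finset.sum_sub_distrib, Finset.mul_sum]
    refine Finset.sum_le_sum fun l _ => ?_
    have hω : 0 ≤ 1 / |modifiedEstimate φ z N l| := by positivity
    rcases eq_or_ne (θ l) 0 with h0 | h0
    · have : 0 ≤ 1 / |modifiedEstimate φ z N l| * |β l| := by positivity
      have : 0 ≤ W * |β l - θ l| := by positivity
      simp only [h0, abs_zero, mul_zero] at *
      linarith
    · rw [← mul_sub]
      have h5 : |θ l| - |β l| ≤ |β l - θ l| := by
        rw [abs_sub_comm]; exact abs_sub_abs_le_abs_sub _ _
      exact (mul_le_mul_of_nonneg_left h5 hω).trans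
        (mul_le_mul_of_nonneg_right (hw l h0) (abs_nonneg _))
  have h5 := mul_le_mul_of_nonneg_left h4 hlam
  rw [h2] at h1
  rw [mul_sub] at h5
  linarith

/-- No subdifferentials are needed: setting the entry `β l` to 0 raises the loss by at most `|β l|
(2 (V + S U) + S U)` and saves `|β l|` times the penalty slope. -/
theorem sparseEstimate_apply_eq_zero {z ν lam : ℕ → ℝ} {θ β : ι → ℝ} {U V S : ℝ}
    (hz : ∀ k, 1 ≤ k → z k = θ ⬝ᵥ φ k + ν k)
    (hν : ∀ l, |∑ k ∈ Finset.Icc 1 N, φ k l * ν k| ≤ V)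
    (hU : ∑ k ∈ Finset.Icc 1 N, ∑ l, φ k l ^ 2 ≤ U)
    (hS : ∑ l, |β l - θ l| ≤ S) (hβ : IsSparseEstimate φ z lam N β) {l : ι} (hl : θ l = 0)
    (hlarge : 2 * V + 3 * (S * U) < lam N * (1 / |modifiedEstimate φ z N l|)) :
    β l = 0 := by
  by_contra hne
  have hU1 : ∀ j, ∑ k ∈ Finset.Icc 1 N, φ k j ^ 2 ≤ U := fun j =>
    (Finset.sum_le_sum fun k _ => Finset.single_le_sum (f := fun j => φ k j ^ 2)
      (fun l _ => sq_nonneg (φ k l)) (Finset.mem_univ j)).trans hU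
  have hU0 : 0 ≤ U := (Finset.sum_nonneg fun k _ => sq_nonneg _).trans (hU1 l)
  have hcorr : ∀ j, |∑ k ∈ Finset.Icc 1 N, φ k j * φ k l| ≤ U := fun j => by
    have h1 : |∑ k ∈ Finset.Icc 1 N, φ k j * φ k l| ≤
        ∑ k ∈ Finset.Icc 1 N, (φ k j ^ 2 + φ k l ^ 2) / 2 := by
      refine (Finset.abs_sum_le_sum_abs _ _).trans (Finset.sum_le_sum fun k _ => ?_)
      rw [abs_le]
      constructor <;> nlinarith [sq_nonneg (φ k j - φ k l), sq_nonneg (φ k j + φ k l)]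
    rw [← Finset.sum_div, Finset.sum_add_distrib] at h1
    linarith [hU1 j, hU1 l]
  have hres : |∑ k ∈ Finset.Icc 1 N, (z k - β ⬝ᵥ φ k) * φ k l| ≤ V + S * U := by
    have e : ∑ k ∈ Finset.Icc 1 N, (z k - β ⬝ᵥ φ k) * φ k l =
        ∑ k ∈ Finset.Icc 1 N, φ k l * ν k -
          (β - θ) ⬝ᵥ fun j => ∑ k ∈ Finset.Icc 1 N, φ k j * φ k l := by
      have e1 : (β - θ) ⬝ᵥ (fun j => ∑ k ∈ Finset.Icc 1 N, φ k j * φ k l) =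
          ∑ k ∈ Finset.Icc 1 N, (β - θ) ⬝ᵥ φ k * φ k l := by
        simp only [dotProduct, Finset.mul_sum, Finset.sum_mul]
        rw [Finset.sum_comm]
        simp only [mul_assoc]
      rw [e1, ← Finset.sum_sub_distrib]
      refine Finset.sum_congr rfl fun k hk => ?_
      rw [hz k (Finset.mem_Icc.1 hk).1, sub_dotProduct]
      ring
    rw [e]
    refine (abs_sub _ _).trans (add_le_add (hν l) ?_)
    refine (dotProduct_le_mul_sum_abs _ _ hcorr).trans ?_
    rw [mul_comm]
    exact mul_le_mul_of_nonneg_right hS hU0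
  have hβS : |β l| ≤ S := by
    have := (Finset.single_le_sum (f := fun l => |β l - θ l|)
      (fun l _ => abs_nonneg _) (Finset.mem_univ l)).trans hS
    simpa [hl] using this
  set β' := Function.update β l 0 with hβ'
  have hd : ∀ k, β' ⬝ᵥ φ k = β ⬝ᵥ φ k - β l * φ k l := fun k => by
    have : β' = β - Pi.single l (β l) := by
      ext j
      rcases eq_or_ne j l with rfl | hj
      · simp [hβ']
      · simp [hβ', hj]
    rw [this, sub_dotProduct, single_dotProduct]
  have h1 := hβ β'
  unfold sparseCriterion at h1
  have h2 : ∑ k ∈ Finset.Icc 1 N, (z k - β' ⬝ᵥ φ k) ^ 2 =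
      ∑ k ∈ Finset.Icc 1 N, (z k - β ⬝ᵥ φ k) ^ 2 +
        2 * β l * ∑ k ∈ Finset.Icc 1 N, (z k - β ⬝ᵥ φ k) * φ k l +
        β l ^ 2 * ∑ k ∈ Finset.Icc 1 N, φ k l ^ 2 := by
    rw [Finset.mul_sum, Finset.mul_sum, ← Finset.sum_add_distrib, ← Finset.sum_add_distrib]
    refine Finset.sum_congr rfl fun k _ => ?_
    rw [hd]; ring
  have h3 : ∑ j, 1 / |modifiedEstimate φ z N j| * |β' j| =
      ∑ j, 1 / |modifiedEstimate φ z N j| * |β j| - 1 / |modifiedEstimate φ z N l| * |β l| := by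
    rw [eq_sub_iff_add_eq, ← Finset.add_sum_erase _ _ (Finset.mem_univ l),
      ← Finset.add_sum_erase _ (fun j => 1 / |modifiedEstimate φ z N j| * |β j|)
        (Finset.mem_univ l)]
    have : ∑ j ∈ Finset.univ.erase l, 1 / |modifiedEstimate φ z N j| * |β' j| =
        ∑ j ∈ Finset.univ.erase l, 1 / |modifiedEstimate φ z N j| * |β j| :=
      Finset.sum_congr rfl fun j hj => by rw [hβ', Function.update_of_ne (Finset.ne_of_mem_erase hj)]
    rw [this, hβ', Function.update_self, abs_zero]
    ring
  rw [h2, h3] at h1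
  have hpos : 0 < |β l| := abs_pos.2 hne
  have h4 : β l * ∑ k ∈ Finset.Icc 1 N, (z k - β ⬝ᵥ φ k) * φ k l ≤ |β l| * (V + S * U) := by
    refine (le_abs_self _).trans ?_
    rw [abs_mul]
    exact mul_le_mul_of_nonneg_left hres hpos.le
  have h5 : β l ^ 2 * ∑ k ∈ Finset.Icc 1 N, φ k l ^ 2 ≤ |β l| * (S * U) := by
    rw [← sq_abs, pow_two, mul_assoc]
    refine mul_le_mul_of_nonneg_left ?_ hpos.le
    exact mul_le_mul hβS (hU1 l) (Finset.sum_nonneg fun _ _ => sq_nonneg _) (hpos.le.trans hβS)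
  have h6 := mul_lt_mul_of_pos_left hlarge hpos
  nlinarith

/-- The correction always points away from zero, so the sizes add; this is why the sign of 0 must
not be 0. -/
theorem abs_modifiedEstimate {z : ℕ → ℝ} (l : ι) :
    |modifiedEstimate φ z N l| =
      |lsEstimate φ z N l| + √(Real.log (lamMax φ N) / lamMin φ N) := by
  have hs := Real.sqrt_nonneg (Real.log (lamMax φ N) / lamMin φ N)
  unfold modifiedEstimate sgnPlus
  split_ifs with h
  · rw [one_mul, abs_of_nonneg (add_nonneg h hs), abs_of_nonneg h]
  · push Not at h
    rw [abs_of_neg h, abs_of_neg (by linarith)]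
    ring

end Excited

/-- Consistency of the sparse estimate along one sample path: the algorithm is eventually well
defined and its estimate has exactly the zeros of the true parameter. -/
theorem eventually_sparseEstimate_eq_zero_iff [DecidableEq ι] (φ : ℕ → ι → ℝ) (z ν : ℕ → ℝ) (θ : ι → ℝ) {ε : ℝ}
    (hε : ε ∈ Set.Ioo (0 : ℝ) (1 / 2)) (hz : ∀ k, 1 ≤ k → z k = θ ⬝ᵥ φ k + ν k)
    (hlow : ∃ c : ℝ, 0 < c ∧ ∀ᶠ N : ℕ in atTop, ∀ x : ι → ℝ,
      c * N * ∑ l, x l ^ 2 ≤ ∑ k ∈ Finset.Icc 1 N, (x ⬝ᵥ φ k) ^ 2)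
    (hup : ∃ C : ℝ, ∀ N : ℕ, ∑ k ∈ Finset.Icc 1 N, ∑ l, φ k l ^ 2 ≤ C * (N : ℝ) ^ (9 / 8 : ℝ))
    (hν : ∀ l, ∃ C : ℝ, ∀ N : ℕ,
      |∑ k ∈ Finset.Icc 1 N, φ k l * ν k| ≤ C * (N : ℝ) ^ (9 / 16 : ℝ)) :
    ∀ᶠ N : ℕ in atTop,
      SparseAlgorithmWellDefined φ z (fun n => (n : ℝ) ^ (1 / 2 + ε)) N ∧
      ∀ β, IsSparseEstimate φ z (fun n => (n : ℝ) ^ (1 / 2 + ε)) N β → ∀ l, β l = 0 ↔ θ l = 0 := by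
  obtain ⟨hε0, hε1⟩ := hε
  obtain ⟨c, hc, hlow⟩ := hlow
  obtain ⟨C₁, hC₁⟩ := hup
  choose C₂ hC₂ using hν
  obtain ⟨C, hC0, hCup, hCν⟩ : ∃ C : ℝ, 0 < C ∧ (∀ N : ℕ,
      ∑ k ∈ Finset.Icc 1 N, ∑ l, φ k l ^ 2 ≤ C * (N : ℝ) ^ (9 / 8 : ℝ)) ∧ ∀ (N : ℕ) l,
      |∑ k ∈ Finset.Icc 1 N, φ k l * ν k| ≤ C * (N : ℝ) ^ (9 / 16 : ℝ) := by
    have h2 : 0 ≤ ∑ l, |C₂ l| := Finset.sum_nonneg fun _ _ => abs_nonneg _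
    have h1 := abs_nonneg C₁
    refine ⟨1 + |C₁| + ∑ l, |C₂ l|, by positivity, fun N => (hC₁ N).trans ?_,
      fun N l => (hC₂ l N).trans ?_⟩
    · refine mul_le_mul_of_nonneg_right ?_ (by positivity)
      linarith [le_abs_self C₁]
    · refine mul_le_mul_of_nonneg_right ?_ (by positivity)
      have := Finset.single_le_sum (f := fun l => |C₂ l|) (fun l _ => abs_nonneg _)
        (Finset.mem_univ l)
      linarith [le_abs_self (C₂ l)]
  set r : ℝ := (Fintype.card ι : ℝ) with hr
  have hr0 : 0 ≤ r := Nat.cast_nonneg _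
  -- Indices with `θ l = 0` contribute `2 / 0 = 0`, so only the support counts.
  set W : ℝ := ∑ l, 2 / |θ l| with hW
  have hW0 : 0 ≤ W := Finset.sum_nonneg fun _ _ => by positivity
  have hWl : ∀ l, 2 / |θ l| ≤ W := fun l =>
    Finset.single_le_sum (f := fun l => 2 / |θ l|) (fun _ _ => by positivity) (Finset.mem_univ l)
  have hpow : ∀ a : ℝ, 0 < a → Tendsto (fun N : ℕ => (N : ℝ) ^ a) atTop atTop := fun a ha =>
    (tendsto_rpow_atTop ha).comp tendsto_natCast_atTop_atTop
  have hneg : ∀ a : ℝ, 0 < a → Tendsto (fun N : ℕ => (N : ℝ) ^ (-a)) atTop (nhds 0) := fun a ha =>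
    (tendsto_rpow_neg_atTop ha).comp tendsto_natCast_atTop_atTop
  -- The two error bounds with `κ = c N`, `V = C N^(9/16)` and `λ_N = N^(1/2+ε)`.
  set E : ℕ → ℝ := fun N => r * C / c * (N : ℝ) ^ (-(7 / 16) : ℝ) with hE
  set S : ℕ → ℝ := fun N => r * (2 * C) / c * (N : ℝ) ^ (-(7 / 16) : ℝ) +
    r * W / c * (N : ℝ) ^ (-(1 / 2 - ε)) with hS
  have hE0 : Tendsto E atTop (nhds 0) := by
    simpa using (hneg (7 / 16) (by norm_num)).const_mul (r * C / c)
  have hS0 : Tendsto S atTop (nhds 0) := by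
    have := ((hneg (7 / 16) (by norm_num)).const_mul (r * (2 * C) / c)).add
      ((hneg (1 / 2 - ε) (by linarith)).const_mul (r * W / c))
    rwa [mul_zero, mul_zero, add_zero] at this
  set K₂ : ℝ := r * C / c + √(1 / c) with hK₂
  have hK₂0 : 0 < K₂ := by positivity
  set K₃ : ℝ := 2 * C + 3 * (r * (2 * C) / c + r * W / c) * C with hK₃
  have hEev : ∀ᶠ N in atTop, ∀ l, θ l ≠ 0 → E N < |θ l| / 2 := by
    rw [eventually_all]
    intro l
    by_cases h : θ l = 0
    · simp [h]
    · have h' : 0 < |θ l| / 2 := by positivity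
      filter_upwards [hE0.eventually_lt_const h'] with N hN _ using hN
  have hSev : ∀ᶠ N in atTop, ∀ l, θ l ≠ 0 → S N < |θ l| := by
    rw [eventually_all]
    intro l
    by_cases h : θ l = 0
    · simp [h]
    · have h' : 0 < |θ l| := by positivity
      filter_upwards [hS0.eventually_lt_const h'] with N hN _ using hN
  -- Uses log t = o(t^(2/9)) with t = C N^(9/8), since 9/8 · 2/9 = 1/4; the bound in the little-o
  -- cancels the power of `C`.
  have hlog : ∀ᶠ N : ℕ in atTop, Real.log (C * (N : ℝ) ^ (9 / 8 : ℝ)) ≤ (N : ℝ) ^ (1 / 4 : ℝ) := by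
    have h1 := (isLittleO_log_rpow_atTop (show (0 : ℝ) < 2 / 9 by norm_num)).bound
      (show (0 : ℝ) < C ^ (-(2 / 9) : ℝ) by positivity)
    have h2 : Tendsto (fun N : ℕ => C * (N : ℝ) ^ (9 / 8 : ℝ)) atTop atTop :=
      (hpow _ (by norm_num)).const_mul_atTop hC0
    filter_upwards [h2.eventually h1, eventually_ge_atTop 1] with N hN hN1
    have hN0 : (0 : ℝ) < N := by exact_mod_cast hN1
    refine (le_abs_self _).trans (hN.trans (le_of_eq ?_))
    rw [Real.norm_eq_abs, abs_of_pos (by positivity), Real.mul_rpow hC0.le (by positivity),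
      ← mul_assoc, ← Real.rpow_add hC0, ← Real.rpow_mul hN0.le]
    norm_num
  filter_upwards [hlow, hEev, hSev, hlog, eventually_ge_atTop 1,
    (hpow (1 / 8) (by norm_num)).eventually_gt_atTop (K₃ * K₂),
    tendsto_natCast_atTop_atTop.eventually_gt_atTop (1 / c)] with N hlowN hEN hSN hlogN hN1 hK hNc
  have hN0 : (0 : ℝ) < N := by exact_mod_cast hN1
  have hN1' : (1 : ℝ) ≤ N := by exact_mod_cast hN1
  have hκ : 0 < c * N := by positivity
  have hκ1 : 1 < c * N := by
    rw [div_lt_iff₀ hc] at hNc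
    linarith
  have hlam : 0 ≤ (fun n : ℕ => (n : ℝ) ^ (1 / 2 + ε)) N := by positivity
  have hV0 : 0 ≤ C * (N : ℝ) ^ (9 / 16 : ℝ) := by positivity
  have e1 : (N : ℝ) ^ (-(7 / 16) : ℝ) = (N : ℝ) ^ (9 / 16 : ℝ) / N := by
    rw [← Real.rpow_sub_one hN0.ne']; norm_num
  have e2 : (N : ℝ) ^ (-(1 / 2 - ε)) = (N : ℝ) ^ (1 / 2 + ε) / N := by
    rw [← Real.rpow_sub_one hN0.ne']; ring_nf
  have hls : ∑ l, |lsEstimate φ z N l - θ l| ≤ E N := by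
    refine (sum_abs_lsEstimate_sub_le hκ hV0 hlowN hz (hCν N)).trans (le_of_eq ?_)
    rw [hE]; dsimp only
    rw [e1, ← hr]
    field_simp
  have hls' : ∀ l, |lsEstimate φ z N l - θ l| ≤ E N := fun l =>
    (Finset.single_le_sum (f := fun l => |lsEstimate φ z N l - θ l|)
      (fun l _ => abs_nonneg _) (Finset.mem_univ l)).trans hls
  -- The dummy index makes `ι` nonempty; for empty `ι` the extreme eigenvalues are default values.
  -- Positivity comes from `c N > 1`, which makes the logarithm positive.
  have hroot : ∀ _ : ι, 0 < √(Real.log (lamMax φ N) / lamMin φ N) ∧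
      √(Real.log (lamMax φ N) / lamMin φ N) ≤ √(1 / c) * (N : ℝ) ^ (-(3 / 8) : ℝ) := by
    intro l
    have : Nonempty ι := ⟨l⟩
    have h1 := le_lamMin hlowN
    have h2 := lamMin_le_lamMax (φ := φ) (N := N)
    have h3 := (lamMax_le (φ := φ) (N := N)).trans (hCup N)
    have h4 : 0 < Real.log (lamMax φ N) := Real.log_pos (by linarith)
    refine ⟨Real.sqrt_pos.2 (div_pos h4 (by linarith)), ?_⟩
    rw [show (N : ℝ) ^ (-(3 / 8) : ℝ) = √((N : ℝ) ^ (-(3 / 4) : ℝ)) by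
      rw [Real.sqrt_eq_rpow, ← Real.rpow_mul hN0.le]; norm_num, ← Real.sqrt_mul (by positivity)]
    refine Real.sqrt_le_sqrt ?_
    calc Real.log (lamMax φ N) / lamMin φ N ≤ (N : ℝ) ^ (1 / 4 : ℝ) / (c * N) := by
          gcongr
          exact (Real.log_le_log (by linarith) h3).trans hlogN
      _ = 1 / c * (N : ℝ) ^ (-(3 / 4) : ℝ) := by
          rw [show (-(3 / 4) : ℝ) = 1 / 4 - 1 by norm_num, Real.rpow_sub_one hN0.ne']
          field_simp
  have hmod : ∀ l, modifiedEstimate φ z N l ≠ 0 := fun l => by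
    rw [← abs_pos, abs_modifiedEstimate]
    have := (hroot l).1
    positivity
  have hw : ∀ l, θ l ≠ 0 → 1 / |modifiedEstimate φ z N l| ≤ W := fun l hl => by
    refine le_trans ?_ (hWl l)
    have h1 : |θ l| / 2 ≤ |modifiedEstimate φ z N l| := by
      rw [abs_modifiedEstimate]
      have h2 := hEN l hl
      have h3 := hls' l
      have h4 := abs_sub_abs_le_abs_sub (θ l) (lsEstimate φ z N l)
      rw [abs_sub_comm] at h4
      linarith [(hroot l).1]
    have h0 : 0 < |θ l| := abs_pos.2 hl
    calc 1 / |modifiedEstimate φ z N l| ≤ 1 / (|θ l| / 2) := by gcongr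
      _ = 2 / |θ l| := by field_simp
  refine ⟨⟨(posDef_gramMatrix hκ hlowN).det_pos.ne'.isUnit, hmod, ?_⟩, fun β hβ l => ?_⟩
  · obtain ⟨β, hβ⟩ := exists_isSparseEstimate (z := z)
      (lam := fun n : ℕ => (n : ℝ) ^ (1 / 2 + ε)) hlam hκ hlowN
    exact ⟨β, hβ, fun β' hβ' => isSparseEstimate_unique hlam hκ hlowN hβ' hβ⟩
  have hβS : ∑ l, |β l - θ l| ≤ S N := by
    refine (sum_abs_sparseEstimate_sub_le hlam hκ hV0 hW0 hlowN hz (hCν N) hw hβ).trans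
      (le_of_eq ?_)
    rw [hS]; dsimp only
    rw [e1, e2, ← hr]
    field_simp
  refine ⟨fun h0 => ?_, fun h0 => ?_⟩
  · by_contra hne
    have h1 := (Finset.single_le_sum (f := fun l => |β l - θ l|)
      (fun l _ => abs_nonneg _) (Finset.mem_univ l)).trans hβS
    simp only [h0, zero_sub, abs_neg] at h1
    exact absurd (hSN l hne) (not_lt.2 h1)
  · refine sparseEstimate_apply_eq_zero hz (hCν N) (hCup N) hβS hβ h0 ?_
    have hm : |modifiedEstimate φ z N l| ≤ K₂ * (N : ℝ) ^ (-(3 / 8) : ℝ) := by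
      rw [abs_modifiedEstimate, hK₂, add_mul]
      refine add_le_add ?_ (hroot l).2
      have h1 := hls' l
      rw [h0, sub_zero] at h1
      refine h1.trans ?_
      refine mul_le_mul_of_nonneg_left ?_ (by positivity)
      exact Real.rpow_le_rpow_of_exponent_le hN1' (by norm_num)
    have hX : 0 < (N : ℝ) ^ (3 / 4 + ε) := by positivity
    -- The exponents on the left are 9/16, 9/8 - 7/16 = 11/16 and 9/8 - (1/2 - ε) = 5/8 + ε, all at
    -- most 3/4 + ε. The penalty slope has exponent 1/2 + ε + 3/8, which leaves a factor N^(1/8) to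
    -- beat the constants.
    have h1 : 2 * (C * (N : ℝ) ^ (9 / 16 : ℝ)) + 3 * (S N * (C * (N : ℝ) ^ (9 / 8 : ℝ))) ≤
        K₃ * (N : ℝ) ^ (3 / 4 + ε) := by
      have a1 : (N : ℝ) ^ (9 / 16 : ℝ) ≤ (N : ℝ) ^ (3 / 4 + ε) :=
        Real.rpow_le_rpow_of_exponent_le hN1' (by linarith)
      have a2 : (N : ℝ) ^ (-(7 / 16) : ℝ) * (N : ℝ) ^ (9 / 8 : ℝ) ≤ (N : ℝ) ^ (3 / 4 + ε) := by
        rw [← Real.rpow_add hN0]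
        exact Real.rpow_le_rpow_of_exponent_le hN1' (by linarith)
      have a3 : (N : ℝ) ^ (-(1 / 2 - ε)) * (N : ℝ) ^ (9 / 8 : ℝ) ≤ (N : ℝ) ^ (3 / 4 + ε) := by
        rw [← Real.rpow_add hN0]
        exact Real.rpow_le_rpow_of_exponent_le hN1' (by linarith)
      have e : 2 * (C * (N : ℝ) ^ (9 / 16 : ℝ)) + 3 * (S N * (C * (N : ℝ) ^ (9 / 8 : ℝ))) =
          2 * C * (N : ℝ) ^ (9 / 16 : ℝ) + 3 * C * (r * (2 * C) / c) *
            ((N : ℝ) ^ (-(7 / 16) : ℝ) * (N : ℝ) ^ (9 / 8 : ℝ)) +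
          3 * C * (r * W / c) * ((N : ℝ) ^ (-(1 / 2 - ε)) * (N : ℝ) ^ (9 / 8 : ℝ)) := by
        rw [hS]; ring
      have e' : K₃ * (N : ℝ) ^ (3 / 4 + ε) = 2 * C * (N : ℝ) ^ (3 / 4 + ε) +
          3 * C * (r * (2 * C) / c) * (N : ℝ) ^ (3 / 4 + ε) +
          3 * C * (r * W / c) * (N : ℝ) ^ (3 / 4 + ε) := by
        rw [hK₃]; ring
      rw [e, e']
      gcongr
    refine h1.trans_lt ?_
    have h2 : (N : ℝ) ^ (1 / 2 + ε) * (1 / (K₂ * (N : ℝ) ^ (-(3 / 8) : ℝ))) ≤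
        (N : ℝ) ^ (1 / 2 + ε) * (1 / |modifiedEstimate φ z N l|) := by
      have : 0 < |modifiedEstimate φ z N l| := abs_pos.2 (hmod l)
      gcongr
    refine lt_of_lt_of_le ?_ h2
    have h3 : (N : ℝ) ^ (1 / 2 + ε) * (1 / (K₂ * (N : ℝ) ^ (-(3 / 8) : ℝ))) =
        (N : ℝ) ^ (1 / 8 : ℝ) * (N : ℝ) ^ (3 / 4 + ε) / K₂ := by
      rw [← Real.rpow_add hN0, Real.rpow_neg hN0.le]
      field_simp
      rw [← Real.rpow_add hN0]
      congr 1; ring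
    rw [h3, lt_div_iff₀ hK₂0]
    nlinarith [mul_lt_mul_of_pos_right hK hX]

end SparseLeastSquares

/-! ### Weighted square summability and Abel summation -/

section WeightedSums

/-- Square summability with the weights `(n + 1) ^ (-9/8)`. It forces partial sums of squares to
grow at most like `N ^ (9/8)`. -/
def WeightedSqSummable (v : ℕ → ℝ) : Prop :=
  Summable fun n : ℕ => v n ^ 2 * ((n : ℝ) + 1) ^ (-(9 / 8) : ℝ)

theorem WeightedSqSummable.exists_sum_sq_le {v : ℕ → ℝ} (hv : WeightedSqSummable v) :
    ∃ C : ℝ, 0 ≤ C ∧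
      ∀ N : ℕ, ∑ n ∈ Finset.range N, v n ^ 2 ≤ C * (N : ℝ) ^ (9 / 8 : ℝ) := by
  refine ⟨∑' n : ℕ, v n ^ 2 * ((n : ℝ) + 1) ^ (-(9 / 8) : ℝ),
    tsum_nonneg fun n => by positivity, fun N => ?_⟩
  refine le_trans ?_ (mul_le_mul_of_nonneg_right
    (hv.sum_le_tsum (Finset.range N) fun n _ => by positivity) (by positivity))
  rw [Finset.sum_mul]
  refine Finset.sum_le_sum fun n hn => ?_
  have hn' : (n : ℝ) + 1 ≤ N := by exact_mod_cast Finset.mem_range.1 hn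
  have hn0 : (0 : ℝ) < (n : ℝ) + 1 := by positivity
  have : 1 ≤ ((n : ℝ) + 1) ^ (-(9 / 8) : ℝ) * (N : ℝ) ^ (9 / 8 : ℝ) := by
    calc (1 : ℝ) = ((n : ℝ) + 1) ^ (-(9 / 8) : ℝ) * ((n : ℝ) + 1) ^ (9 / 8 : ℝ) := by
          rw [← Real.rpow_add hn0]; norm_num
      _ ≤ _ := by gcongr
  nlinarith [sq_nonneg (v n)]

/-- Abel summation: bounded partial sums of `t n (n + 1) ^ (-e)` bound those of `t` by `N ^ e`. -/
theorem abs_sum_le_of_weighted_sum_bounded {t : ℕ → ℝ} {e M : ℝ} (he : 0 ≤ e)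
    (h : ∀ N, |∑ n ∈ Finset.range N, t n * ((n : ℝ) + 1) ^ (-e)| ≤ M) (N : ℕ) :
    |∑ n ∈ Finset.range N, t n| ≤ 2 * M * (N : ℝ) ^ e := by
  have hM : 0 ≤ M := (abs_nonneg _).trans (h 0)
  set S : ℕ → ℝ := fun N => ∑ n ∈ Finset.range N, t n * ((n : ℝ) + 1) ^ (-e) with hS
  -- The increment of the left-hand difference is `-S N ((N + 1)^e - N^e)`, so the bounds telescope
  -- to `M N^e`.
  have key : |∑ n ∈ Finset.range N, t n - S N * (N : ℝ) ^ e| ≤ M * (N : ℝ) ^ e := by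
    induction N with
    | zero => simp [hS]; positivity
    | succ N ih =>
      have h1 : t N = (S (N + 1) - S N) * ((N : ℝ) + 1) ^ e := by
        have hN : (0 : ℝ) < (N : ℝ) + 1 := by positivity
        rw [hS]; dsimp only
        rw [Finset.sum_range_succ, add_sub_cancel_left, mul_assoc, ← Real.rpow_add hN]
        simp
      have h2 : (N : ℝ) ^ e ≤ ((N : ℝ) + 1) ^ e := by
        gcongr; linarith
      rw [Finset.sum_range_succ, h1]
      push_cast
      have h3 : ∑ n ∈ Finset.range N, t n + (S (N + 1) - S N) * ((N : ℝ) + 1) ^ e -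
          S (N + 1) * ((N : ℝ) + 1) ^ e = (∑ n ∈ Finset.range N, t n - S N * (N : ℝ) ^ e) -
          S N * (((N : ℝ) + 1) ^ e - (N : ℝ) ^ e) := by ring
      rw [h3]
      refine (abs_sub _ _).trans ?_
      have h4 : |S N * (((N : ℝ) + 1) ^ e - (N : ℝ) ^ e)| ≤
          M * (((N : ℝ) + 1) ^ e - (N : ℝ) ^ e) := by
        rw [abs_mul, abs_of_nonneg (sub_nonneg.2 h2)]
        exact mul_le_mul_of_nonneg_right (h N) (sub_nonneg.2 h2)
      linarith
  have h1 : |S N * (N : ℝ) ^ e| ≤ M * (N : ℝ) ^ e := by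
    rw [abs_mul, abs_of_nonneg (show 0 ≤ (N : ℝ) ^ e by positivity)]
    exact mul_le_mul_of_nonneg_right (h N) (by positivity)
  calc |∑ n ∈ Finset.range N, t n|
      = |(∑ n ∈ Finset.range N, t n - S N * (N : ℝ) ^ e) + S N * (N : ℝ) ^ e| := by ring_nf
    _ ≤ _ := abs_add_le _ _
    _ ≤ _ := by linarith

theorem summable_weights : Summable fun n : ℕ => ((n : ℝ) + 1) ^ (-(9 / 8) : ℝ) := by
  have := (summable_nat_add_iff 1).2
    (Real.summable_nat_rpow.2 (show (-(9 / 8) : ℝ) < -1 by norm_num))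
  simpa using this

end WeightedSums

/-! ### Sums of martingale differences against predictable factors -/

section MartingaleSums

open scoped ENNReal

variable {Ω : Type*} {mΩ : MeasurableSpace Ω} {P : Measure Ω}

/-- The hypothesis compares the measures with densities `X` and `σ` after restriction to `m`, and
integrals of `m`-measurable functions see only these restrictions. It plays the role of pulling `f`
out of a conditional expectation. -/
theorem lintegral_mul_le_of_forall_setLIntegral_le {m : MeasurableSpace Ω} (hm : m ≤ mΩ)
    {X σ f : Ω → ℝ≥0∞} (hX : Measurable[mΩ] X) (hσ : Measurable[mΩ] σ)
    (h : ∀ A, MeasurableSet[m] A → ∫⁻ ω in A, X ω ∂P ≤ ∫⁻ ω in A, σ ω ∂P)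
    (hf : Measurable[m] f) : ∫⁻ ω, f ω * X ω ∂P ≤ ∫⁻ ω, f ω * σ ω ∂P := by
  have hf' : Measurable[mΩ] f := hf.mono hm le_rfl
  have h1 : ∀ Y : Ω → ℝ≥0∞, Measurable[mΩ] Y →
      ∫⁻ ω, f ω * Y ω ∂P = ∫⁻ ω, f ω ∂((P.withDensity Y).trim hm) := fun Y hY => by
    rw [lintegral_trim hm hf, lintegral_withDensity_eq_lintegral_mul P hY hf']
    simp [mul_comm]
  rw [h1 X hX, h1 σ hσ]
  refine lintegral_mono' (Measure.le_iff.2 fun A hA => ?_) le_rfl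
  rw [trim_measurableSet_eq hm hA, trim_measurableSet_eq hm hA,
    withDensity_apply _ (hm A hA), withDensity_apply _ (hm A hA)]
  exact h A hA

theorem summable_of_tsum_ofReal_ne_top {x : ℕ → ℝ} (hx : ∀ n, 0 ≤ x n)
    (h : ∑' n, ENNReal.ofReal (x n) ≠ ∞) : Summable x := by
  have h1 : Summable fun n => (x n).toNNReal := ENNReal.tsum_coe_ne_top_iff_summable.1 h
  have h2 := NNReal.summable_coe.2 h1
  simpa [Real.coe_toNNReal _ (hx _)] using h2

theorem ae_summable_of_tsum_lintegral_ne_top {x : ℕ → Ω → ℝ} (hx : ∀ n ω, 0 ≤ x n ω)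
    (hm : ∀ n, Measurable (x n)) (h : ∑' n, ∫⁻ ω, ENNReal.ofReal (x n ω) ∂P ≠ ∞) :
    ∀ᵐ ω ∂P, Summable fun n => x n ω := by
  rw [← lintegral_tsum fun n => (hm n).ennreal_ofReal.aemeasurable] at h
  filter_upwards [ae_lt_top (Measurable.tsum fun n => (hm n).ennreal_ofReal) h] with ω hω
  exact summable_of_tsum_ofReal_ne_top (fun n => hx n ω) hω.ne

variable {ℱ : Filtration ℕ mΩ}

/-- A martingale with square summable increments converges almost surely. -/
theorem ae_tendsto_sum_of_condExp_eq_zero [IsProbabilityMeasure P] {d : ℕ → Ω → ℝ}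
    (hmeas : ∀ n, Measurable[ℱ (n + 1)] (d n)) (hce : ∀ n, P[d n | ℱ n] =ᵐ[P] 0)
    (hsum : ∑' n, ∫⁻ ω, ENNReal.ofReal (d n ω ^ 2) ∂P ≠ ∞) :
    ∀ᵐ ω ∂P, ∃ l, Tendsto (fun n => ∑ k ∈ Finset.range n, d k ω) atTop (nhds l) := by
  have hmeas' : ∀ n, Measurable (d n) := fun n => (hmeas n).mono (ℱ.le _) le_rfl
  have hsq : ∀ n, Integrable (fun ω => d n ω ^ 2) P := fun n => by
    refine ⟨((hmeas' n).pow_const 2).aestronglyMeasurable, ?_⟩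
    rw [hasFiniteIntegral_iff_ofReal (ae_of_all _ fun ω => sq_nonneg _)]
    exact lt_of_le_of_lt (ENNReal.le_tsum n) hsum.lt_top
  have hL2 : ∀ n, MemLp (d n) 2 P := fun n =>
    (memLp_two_iff_integrable_sq (hmeas' n).aestronglyMeasurable).2 (hsq n)
  set f : ℕ → Ω → ℝ := fun n ω => ∑ k ∈ Finset.range n, d k ω with hf
  have hfL2 : ∀ n, MemLp (f n) 2 P := fun n => memLp_finsetSum _ fun k _ => hL2 k
  have hfm : ∀ n, Measurable[ℱ n] (f n) := fun n =>
    Finset.measurable_fun_sum _ fun k hk => (hmeas k).mono (ℱ.mono (Finset.mem_range.1 hk)) le_rfl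
  have hdint : ∀ n, Integrable (d n) P := fun n => (hL2 n).integrable one_le_two
  have hfint : ∀ n, Integrable (f n) P := fun n => (hfL2 n).integrable one_le_two
  have hfs : ∀ n, f (n + 1) = f n + d n := fun n => by
    ext ω; simp [hf, Finset.sum_range_succ]
  have hmart : Martingale f ℱ P := by
    refine martingale_nat (fun n => (hfm n).stronglyMeasurable) hfint fun n => ?_
    rw [hfs]
    refine EventuallyEq.symm ((condExp_add (hfint n) (hdint n) _).trans ?_)
    rw [condExp_of_stronglyMeasurable (ℱ.le n) (hfm n).stronglyMeasurable (hfint n)]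
    filter_upwards [hce n] with ω hω
    simp [hω]
  -- Increments are orthogonal to the past, so second moments add up.
  have horth : ∀ n, ∫ ω, f n ω * d n ω ∂P = 0 := fun n => by
    have h1 : Integrable (f n * d n) P := (hfL2 n).integrable_mul (hL2 n)
    have h2 := condExp_mul_of_stronglyMeasurable_left (hfm n).stronglyMeasurable h1 (hdint n)
    change ∫ ω, (f n * d n) ω ∂P = 0
    rw [← integral_condExp (ℱ.le n)]
    refine integral_eq_zero_of_ae ?_
    filter_upwards [h2, hce n] with ω h3 h4
    simp [h3, h4]
  have hint2 : ∀ n, ∫ ω, f n ω ^ 2 ∂P = ∑ k ∈ Finset.range n, ∫ ω, d k ω ^ 2 ∂P := fun n => by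
    induction n with
    | zero => simp [hf]
    | succ n ih =>
      rw [Finset.sum_range_succ, ← ih, hfs]
      have e : ∀ ω, (f n + d n) ω ^ 2 = f n ω ^ 2 + (2 * (f n ω * d n ω) + d n ω ^ 2) := fun ω => by
        simp only [Pi.add_apply]; ring
      simp only [e]
      have h1 : Integrable (fun ω => f n ω * d n ω) P := (hfL2 n).integrable_mul (hL2 n)
      have h2 : Integrable (fun ω => 2 * (f n ω * d n ω)) P := h1.const_mul 2
      have h3 : Integrable (fun ω => 2 * (f n ω * d n ω) + d n ω ^ 2) P := h2.add (hsq n)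
      rw [integral_add (hfL2 n).integrable_sq h3, integral_add h2 (hsq n),
        integral_const_mul, horth]
      ring
  -- The L² bound gives an L¹ bound through |x| ≤ 1 + x², as the martingale convergence theorem
  -- requires.
  have hbdd : ∀ n, eLpNorm (f n) 1 P ≤
      ((1 + ∑' n, ∫⁻ ω, ENNReal.ofReal (d n ω ^ 2) ∂P).toNNReal : ℝ≥0∞) := fun n => by
    rw [ENNReal.coe_toNNReal (by simpa using hsum), eLpNorm_one_eq_lintegral_enorm]
    calc ∫⁻ ω, ‖f n ω‖ₑ ∂P ≤ ∫⁻ ω, (1 + ENNReal.ofReal (f n ω ^ 2)) ∂P := by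
          refine lintegral_mono fun ω => ?_
          rw [Real.enorm_eq_ofReal_abs, ← ENNReal.ofReal_one,
            ← ENNReal.ofReal_add zero_le_one (sq_nonneg _)]
          refine ENNReal.ofReal_le_ofReal ?_
          rw [← sq_abs]
          nlinarith [sq_nonneg (|f n ω| - 1), abs_nonneg (f n ω)]
      _ = 1 + ∫⁻ ω, ENNReal.ofReal (f n ω ^ 2) ∂P := by
          rw [lintegral_add_left measurable_const]; simp
      _ ≤ _ := by
          gcongr
          rw [← ofReal_integral_eq_lintegral_ofReal (hfL2 n).integrable_sq
            (ae_of_all _ fun ω => sq_nonneg _), hint2,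
            ENNReal.ofReal_sum_of_nonneg fun k _ => integral_nonneg fun ω => sq_nonneg _]
          refine le_trans (Finset.sum_le_sum fun k _ => ?_) (ENNReal.sum_le_tsum _)
          rw [ofReal_integral_eq_lintegral_ofReal (hsq k) (ae_of_all _ fun ω => sq_nonneg _)]
  exact hmart.submartingale.exists_ae_tendsto_of_bdd hbdd

/-- A martingale difference sequence `D` (with `D n` known at time `n + 1`) whose conditional
second moments are dominated by an almost surely bounded adapted sequence `σ`. -/
structure IsBoundedVarianceMDS (P : Measure Ω) (ℱ : Filtration ℕ mΩ) (D : ℕ → Ω → ℝ)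
    (σ : ℕ → Ω → ℝ≥0∞) : Prop where
  measurable : ∀ n, Measurable[ℱ (n + 1)] (D n)
  integrable : ∀ n, Integrable (D n) P
  condExp_eq : ∀ n, P[D n | ℱ n] =ᵐ[P] 0
  measurable_var : ∀ n, Measurable[ℱ n] (σ n)
  setLIntegral_le : ∀ n A, MeasurableSet[ℱ n] A →
    ∫⁻ ω in A, ENNReal.ofReal (D n ω ^ 2) ∂P ≤ ∫⁻ ω in A, σ n ω ∂P
  bounded : ∀ᵐ ω ∂P, ∃ M : ℕ, ∀ n, σ n ω ≤ M

/-- The test includes the current term, so the kept terms never overshoot `M`; once the full sum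
passes `M`, nothing more is kept. The minimum with the full sum makes the induction close. -/
theorem sum_sq_truncated_le (a : ℕ → ℝ) {M : ℝ} (hM : 0 ≤ M) (N : ℕ) :
    ∑ n ∈ Finset.range N,
      (if ∑ j ∈ Finset.range (n + 1), a j ^ 2 ≤ M then a n ^ 2 else 0) ≤ M := by
  suffices h : ∑ n ∈ Finset.range N,
      (if ∑ j ∈ Finset.range (n + 1), a j ^ 2 ≤ M then a n ^ 2 else 0) ≤
      min M (∑ n ∈ Finset.range N, a n ^ 2) from h.trans (min_le_left _ _)
  induction N with
  | zero => simp [hM]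
  | succ N ih =>
    obtain ⟨ih1, ih2⟩ := le_min_iff.1 ih
    rw [Finset.sum_range_succ, Finset.sum_range_succ (fun n => a n ^ 2) N]
    split_ifs with h
    · exact le_min (by linarith) (by linarith)
    · exact le_min (by linarith) (by nlinarith [sq_nonneg (a N)])

namespace IsBoundedVarianceMDS

variable [IsProbabilityMeasure P] {D a : ℕ → Ω → ℝ} {σ : ℕ → Ω → ℝ≥0∞}

/-- Localisation. Keeping `a n` only while `∑ a²` and `σ n` are at most `M` is a predictable
truncation whose transform has total variance at most `M * M`, hence converges almost surely. On a
path with `∑ a²` finite and `σ` bounded, a large integer `M` truncates nothing. -/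
theorem ae_bounded_sum (hD : IsBoundedVarianceMDS P ℱ D σ) (ha : ∀ n, Measurable[ℱ n] (a n)) :
    ∀ᵐ ω ∂P, Summable (fun n => a n ω ^ 2) →
      ∃ M, ∀ N, |∑ n ∈ Finset.range N, a n ω * D n ω| ≤ M := by
  classical
  let T : ℕ → ℕ → Set Ω := fun M n =>
    {ω | ∑ j ∈ Finset.range (n + 1), a j ω ^ 2 ≤ M} ∩ {ω | σ n ω ≤ M}
  have hT : ∀ M n, MeasurableSet[ℱ n] (T M n) := fun M n => by
    refine @MeasurableSet.inter _ (ℱ n) _ _ ?_ ?_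
    · have h : Measurable[ℱ n] fun ω => ∑ j ∈ Finset.range (n + 1), a j ω ^ 2 :=
        Finset.measurable_fun_sum _ fun j hj =>
          ((ha j).mono (ℱ.mono (Nat.lt_succ_iff.1 (Finset.mem_range.1 hj))) le_rfl).pow_const 2
      exact h measurableSet_Iic
    · exact hD.measurable_var n measurableSet_Iic
  let c : ℕ → ℕ → Ω → ℝ := fun M n => (T M n).indicator (a n)
  have hc : ∀ M n, Measurable[ℱ n] (c M n) := fun M n => (ha n).indicator (hT M n)
  have hcsum : ∀ (M : ℕ) ω, ∑' n, ENNReal.ofReal (c M n ω ^ 2) ≤ M := fun M ω => by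
    refine ENNReal.tsum_le_of_sum_range_le fun N => ?_
    rw [← ENNReal.ofReal_sum_of_nonneg fun n _ => sq_nonneg _, ← ENNReal.ofReal_natCast]
    refine ENNReal.ofReal_le_ofReal
      (le_trans (Finset.sum_le_sum fun n _ => ?_) (sum_sq_truncated_le (fun n => a n ω) M.cast_nonneg
        N))
    by_cases h : ω ∈ T M n
    · have h1 : ∑ j ∈ Finset.range (n + 1), a j ω ^ 2 ≤ M := h.1
      simp [c, Set.indicator_of_mem h, h1]
    · simp only [c, Set.indicator_of_notMem h]
      split_ifs
      · simpa using sq_nonneg (a n ω)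
      · simp
  have hconv : ∀ M : ℕ, ∀ᵐ ω ∂P, ∃ l,
      Tendsto (fun N => ∑ n ∈ Finset.range N, c M n ω * D n ω) atTop (nhds l) := fun M => by
    have hbound : ∑' n, ∫⁻ ω, ENNReal.ofReal ((c M n ω * D n ω) ^ 2) ∂P ≠ ∞ := by
      have h1 : ∀ n, ∫⁻ ω, ENNReal.ofReal ((c M n ω * D n ω) ^ 2) ∂P ≤
          M * ∫⁻ ω, ENNReal.ofReal (c M n ω ^ 2) ∂P := fun n => by
        simp only [mul_pow, ENNReal.ofReal_mul (sq_nonneg _)]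
        refine (lintegral_mul_le_of_forall_setLIntegral_le (ℱ.le n)
          (((hD.measurable n).mono (ℱ.le _) le_rfl).pow_const 2).ennreal_ofReal
          ((hD.measurable_var n).mono (ℱ.le _) le_rfl) (hD.setLIntegral_le n)
          ((hc M n).pow_const 2).ennreal_ofReal).trans ?_
        rw [← lintegral_const_mul _
          (((hc M n).mono (ℱ.le n) le_rfl).pow_const 2).ennreal_ofReal]
        refine lintegral_mono fun ω => ?_
        by_cases h : ω ∈ T M n
        · rw [mul_comm]
          gcongr
          exact h.2
        · simp [c, Set.indicator_of_notMem h]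
      refine ne_top_of_le_ne_top ?_ (ENNReal.tsum_le_tsum h1)
      rw [ENNReal.tsum_mul_left, ← lintegral_tsum fun n =>
        (((hc M n).mono (ℱ.le n) le_rfl).pow_const 2).ennreal_ofReal.aemeasurable]
      refine ne_top_of_le_ne_top (b := (M : ℝ≥0∞) * M)
        (ENNReal.mul_ne_top (ENNReal.natCast_ne_top _) (ENNReal.natCast_ne_top _)) ?_
      gcongr
      exact (lintegral_mono fun ω => hcsum M ω).trans (by simp)
    refine ae_tendsto_sum_of_condExp_eq_zero (ℱ := ℱ) (d := fun n ω => c M n ω * D n ω)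
      (fun n => ((hc M n).mono (ℱ.mono n.le_succ) le_rfl).mul (hD.measurable n)) (fun n => ?_) hbound
    have hm : Measurable (fun ω => c M n ω * D n ω) :=
      ((hc M n).mono (ℱ.le _) le_rfl).mul ((hD.measurable n).mono (ℱ.le _) le_rfl)
    have hi : Integrable (c M n * D n) P := by
      refine MemLp.integrable one_le_two
        ((memLp_two_iff_integrable_sq hm.aestronglyMeasurable).2
        ⟨(hm.pow_const 2).aestronglyMeasurable, ?_⟩)
      rw [hasFiniteIntegral_iff_ofReal (ae_of_all _ fun ω => sq_nonneg _)]
      exact lt_of_le_of_lt (ENNReal.le_tsum n) hbound.lt_top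
    refine (condExp_mul_of_stronglyMeasurable_left (hc M n).stronglyMeasurable hi
      (hD.integrable n)).trans ?_
    filter_upwards [hD.condExp_eq n] with ω hω
    simp [hω]
  filter_upwards [ae_all_iff.2 hconv, hD.bounded] with ω hω ⟨M₁, hM₁⟩ hsum
  obtain ⟨M₂, hM₂⟩ := exists_nat_ge (∑' n, a n ω ^ 2)
  obtain ⟨l, hl⟩ := hω (max M₁ M₂)
  have hmem : ∀ n, ω ∈ T (max M₁ M₂) n := fun n =>
    ⟨(hsum.sum_le_tsum _ fun _ _ => sq_nonneg _).trans
        (hM₂.trans (by exact_mod_cast le_max_right _ _)),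
      (hM₁ n).trans (by exact_mod_cast le_max_left _ _)⟩
  have he : ∀ n, c (max M₁ M₂) n ω = a n ω := fun n => Set.indicator_of_mem (hmem n) _
  simp only [he] at hl
  obtain ⟨M, hM⟩ := (Metric.isBounded_range_of_tendsto _ hl).exists_norm_le
  exact ⟨M, fun N => hM _ ⟨N, rfl⟩⟩

/-- Normalising `a n` by (n+1)^(-9/16), the square root of the weight, makes it square summable;
Abel summation then removes the normalisation at the price N^(9/16). -/
theorem ae_abs_sum_le (hD : IsBoundedVarianceMDS P ℱ D σ) (ha : ∀ n, Measurable[ℱ n] (a n)) :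
    ∀ᵐ ω ∂P, WeightedSqSummable (fun n => a n ω) →
      ∃ C : ℝ, ∀ N : ℕ, |∑ n ∈ Finset.range N, a n ω * D n ω| ≤ C * (N : ℝ) ^ (9 / 16 : ℝ) := by
  filter_upwards [hD.ae_bounded_sum (a := fun n ω => a n ω * ((n : ℝ) + 1) ^ (-(9 / 16) : ℝ))
    fun n => (ha n).mul_const _] with ω hω hsum
  have h1 : Summable fun n : ℕ => (a n ω * ((n : ℝ) + 1) ^ (-(9 / 16) : ℝ)) ^ 2 := by
    refine hsum.congr fun n => ?_
    have hn : (0 : ℝ) < (n : ℝ) + 1 := by positivity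
    rw [mul_pow, ← Real.rpow_mul_natCast hn.le]
    norm_num
  obtain ⟨M, hM⟩ := hω h1
  refine ⟨2 * M, abs_sum_le_of_weighted_sum_bounded (by norm_num) fun N => ?_⟩
  convert hM N using 3 with n
  ring

/-- On the event that `σ n` is at most `M`, the second moment of `D n` is at most `M`, and the
weights are summable since 9/8 > 1. A bounded path lies in all these events for some `M`. -/
theorem ae_weightedSqSummable (hD : IsBoundedVarianceMDS P ℱ D σ) :
    ∀ᵐ ω ∂P, WeightedSqSummable fun n => D n ω := by
  classical
  let T : ℕ → ℕ → Set Ω := fun M n => {ω | σ n ω ≤ M}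
  have hT : ∀ M n, MeasurableSet[ℱ n] (T M n) := fun M n =>
    hD.measurable_var n measurableSet_Iic
  have hDm : ∀ n, Measurable (D n) := fun n => (hD.measurable n).mono (ℱ.le _) le_rfl
  have key : ∀ M : ℕ, ∀ᵐ ω ∂P, Summable fun n : ℕ =>
      (T M n).indicator (fun ω => D n ω ^ 2) ω * ((n : ℝ) + 1) ^ (-(9 / 8) : ℝ) := fun M => by
    refine ae_summable_of_tsum_lintegral_ne_top
      (fun n ω => mul_nonneg (Set.indicator_nonneg (fun _ _ => sq_nonneg _) _) (by positivity))
      (fun n => (((hDm n).pow_const 2).indicator (ℱ.le n _ (hT M n))).mul_const _) ?_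
    have h1 : ∀ n : ℕ, ∫⁻ ω, ENNReal.ofReal ((T M n).indicator (fun ω => D n ω ^ 2) ω *
        ((n : ℝ) + 1) ^ (-(9 / 8) : ℝ)) ∂P ≤
        M * ENNReal.ofReal (((n : ℝ) + 1) ^ (-(9 / 8) : ℝ)) := fun n => by
      have e : ∀ ω, ENNReal.ofReal ((T M n).indicator (fun ω => D n ω ^ 2) ω *
          ((n : ℝ) + 1) ^ (-(9 / 8) : ℝ)) =
          (T M n).indicator (fun ω => ENNReal.ofReal (D n ω ^ 2)) ω *
            ENNReal.ofReal (((n : ℝ) + 1) ^ (-(9 / 8) : ℝ)) := fun ω => by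
        rw [ENNReal.ofReal_mul (Set.indicator_nonneg (fun _ _ => sq_nonneg _) _)]
        by_cases h : ω ∈ T M n <;> simp [h]
      simp only [e]
      rw [lintegral_mul_const _ (((hDm n).pow_const 2).ennreal_ofReal.indicator
        (ℱ.le n _ (hT M n))), lintegral_indicator (ℱ.le n _ (hT M n))]
      gcongr
      refine (hD.setLIntegral_le n _ (hT M n)).trans ?_
      have h2 : ∫⁻ ω in T M n, σ n ω ∂P ≤ ∫⁻ _ in T M n, (M : ℝ≥0∞) ∂P :=
        setLIntegral_mono measurable_const fun ω hω => hω
      refine h2.trans ?_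
      rw [setLIntegral_const]
      calc (M : ℝ≥0∞) * P (T M n) ≤ M * 1 := by gcongr; exact prob_le_one
        _ = M := mul_one _
    refine ne_top_of_le_ne_top ?_ (ENNReal.tsum_le_tsum h1)
    rw [ENNReal.tsum_mul_left]
    refine ENNReal.mul_ne_top (ENNReal.natCast_ne_top _) ?_
    rw [← ENNReal.ofReal_tsum_of_nonneg (fun n => by positivity) summable_weights]
    exact ENNReal.ofReal_ne_top
  filter_upwards [ae_all_iff.2 key, hD.bounded] with ω hω ⟨M, hM⟩
  refine (hω M).congr fun n => ?_
  rw [Set.indicator_of_mem (show ω ∈ T M n from hM n)]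

end IsBoundedVarianceMDS

end MartingaleSums

/-! ### Closure properties of the weighted class -/

section WeightedSpace

theorem weightedSqSummable_congr_of_le {v v' : ℕ → ℝ} (m : ℕ) (h : ∀ n, m ≤ n → v n = v' n) :
    WeightedSqSummable v ↔ WeightedSqSummable v' := by
  unfold WeightedSqSummable
  rw [← summable_nat_add_iff m, ← summable_nat_add_iff m (f := fun n : ℕ =>
    v' n ^ 2 * ((n : ℝ) + 1) ^ (-(9 / 8) : ℝ))]
  refine summable_congr fun n => ?_
  rw [h _ (Nat.le_add_left m n)]

theorem weight_antitone {m n : ℕ} (h : m ≤ n) :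
    ((n : ℝ) + 1) ^ (-(9 / 8) : ℝ) ≤ ((m : ℝ) + 1) ^ (-(9 / 8) : ℝ) :=
  Real.rpow_le_rpow_of_nonpos (by positivity) (by gcongr) (by norm_num)

/-- Shifted weights are comparable: they decrease, and `n + m + 1 ≤ (m + 1)(n + 1)`. -/
theorem weightedSqSummable_nat_add_iff {v : ℕ → ℝ} (m : ℕ) :
    WeightedSqSummable (fun n => v (n + m)) ↔ WeightedSqSummable v := by
  constructor
  · intro h
    refine (summable_nat_add_iff m).1 (Summable.of_nonneg_of_le (fun n => by positivity)
      (fun n => ?_) h)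
    exact mul_le_mul_of_nonneg_left (weight_antitone (Nat.le_add_right n m)) (sq_nonneg _)
  · intro h
    refine Summable.of_nonneg_of_le (fun n => by positivity) (fun n => ?_)
      (((summable_nat_add_iff m).2 h).mul_left (((m : ℝ) + 1) ^ (9 / 8 : ℝ)))
    have hm : (0 : ℝ) < (m : ℝ) + 1 := by positivity
    have hn : (0 : ℝ) < (n : ℝ) + 1 := by positivity
    have h1 : (((m : ℝ) + 1) * ((n : ℝ) + 1)) ^ (-(9 / 8) : ℝ) ≤
        (((n + m : ℕ) : ℝ) + 1) ^ (-(9 / 8) : ℝ) := by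
      refine Real.rpow_le_rpow_of_nonpos (by positivity) ?_ (by norm_num)
      push_cast
      nlinarith [mul_nonneg (Nat.cast_nonneg (α := ℝ) m) (Nat.cast_nonneg (α := ℝ) n)]
    rw [Real.mul_rpow hm.le hn.le] at h1
    have h2 : ((n : ℝ) + 1) ^ (-(9 / 8) : ℝ) ≤
        ((m : ℝ) + 1) ^ (9 / 8 : ℝ) * (((n + m : ℕ) : ℝ) + 1) ^ (-(9 / 8) : ℝ) := by
      calc ((n : ℝ) + 1) ^ (-(9 / 8) : ℝ) = ((m : ℝ) + 1) ^ (9 / 8 : ℝ) *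
            (((m : ℝ) + 1) ^ (-(9 / 8) : ℝ) * ((n : ℝ) + 1) ^ (-(9 / 8) : ℝ)) := by
            rw [← mul_assoc, ← Real.rpow_add hm]; norm_num
        _ ≤ _ := by gcongr
    nlinarith [sq_nonneg (v (n + m))]

theorem WeightedSqSummable.add {v v' : ℕ → ℝ} (h : WeightedSqSummable v)
    (h' : WeightedSqSummable v') : WeightedSqSummable fun n => v n + v' n := by
  refine Summable.of_nonneg_of_le (fun n => by positivity) (fun n => ?_)
    ((h.mul_left 2).add (h'.mul_left 2))
  have h1 : (v n + v' n) ^ 2 ≤ 2 * v n ^ 2 + 2 * v' n ^ 2 := by nlinarith [sq_nonneg (v n - v' n)]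
  refine (mul_le_mul_of_nonneg_right h1 (by positivity)).trans (le_of_eq (by ring))

theorem WeightedSqSummable.const_mul {v : ℕ → ℝ} (h : WeightedSqSummable v) (c : ℝ) :
    WeightedSqSummable fun n => c * v n := by
  refine (h.mul_left (c ^ 2)).congr fun n => ?_
  ring

theorem weightedSqSummable_const (c : ℝ) : WeightedSqSummable fun _ => c :=
  summable_weights.mul_left _

theorem weightedSqSummable_sum {ι : Type*} (s : Finset ι) {v : ι → ℕ → ℝ}
    (h : ∀ i ∈ s, WeightedSqSummable (v i)) : WeightedSqSummable fun n => ∑ i ∈ s, v i n := by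
  classical
  induction s using Finset.induction_on with
  | empty => simpa using weightedSqSummable_const 0
  | insert i s hi ih =>
    simp only [Finset.sum_insert hi]
    exact (h i (Finset.mem_insert_self _ _)).add
      (ih fun j hj => h j (Finset.mem_insert_of_mem hj))

end WeightedSpace

/-! ### Backward shift and inversion of stable filters -/

section Backshift

open Polynomial

variable (K : Type*) [Field K]

/-- The backward shift `(S t)_k = t_{k-1}` on two-sided sequences. -/
def backshift : Module.End K (ℤ → K) := LinearMap.funLeft K K fun k => k - 1

variable {K}

@[simp]
theorem backshift_apply (t : ℤ → K) (k : ℤ) : backshift K t k = t (k - 1) := rfl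

@[simp]
theorem backshift_pow_apply (m : ℕ) (t : ℤ → K) (k : ℤ) :
    (backshift K ^ m) t k = t (k - m) := by
  induction m generalizing k with
  | zero => simp
  | succ m ih =>
    rw [pow_succ', Module.End.mul_apply, backshift_apply, ih]
    congr 1
    push_cast
    ring

theorem aeval_backshift_apply {Q : K[X]} {n : ℕ} (hQ : Q.natDegree < n) (t : ℤ → K) (k : ℤ) :
    aeval (backshift K) Q t k = ∑ m ∈ Finset.range n, Q.coeff m * t (k - m) := by
  rw [aeval_eq_sum_range' hQ]
  simp

theorem aeval_backshift_mul (Q Q' : K[X]) (t : ℤ → K) :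
    aeval (backshift K) (Q * Q') t = aeval (backshift K) Q (aeval (backshift K) Q' t) := by
  rw [map_mul, Module.End.mul_apply]

/-- Solving for `v n` gives a recursion contracting by `c = 1 / ‖r‖ < 1`. The split `c² (x + e)² ≤ c
x² + c² / (1 - c) e²` keeps a factor below 1 after squaring, and since the weights decrease, each
partial sum is at most `A + c` times the preceding one. -/
theorem summable_of_summable_backshift_sub {r : ℂ} (hr : 1 < ‖r‖) {v : ℤ → ℂ}
    (h : Summable fun n : ℕ => ‖v (n - 1) - r * v n‖ ^ 2 * ((n : ℝ) + 1) ^ (-(9 / 8) : ℝ)) :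
    Summable fun n : ℕ => ‖v n‖ ^ 2 * ((n : ℝ) + 1) ^ (-(9 / 8) : ℝ) := by
  set e : ℕ → ℂ := fun n => v (n - 1) - r * v n with he
  set wt : ℕ → ℝ := fun n => ((n : ℝ) + 1) ^ (-(9 / 8) : ℝ) with hwt
  have hwt0 : ∀ n, 0 ≤ wt n := fun n => by positivity
  have hr0 : 0 < ‖r‖ := by linarith
  set c : ℝ := 1 / ‖r‖ with hc
  have hc0 : 0 < c := by positivity
  have hc1 : c < 1 := by rw [hc, div_lt_one hr0]; exact hr
  have h1c : 0 < 1 - c := by linarith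
  have hstep : ∀ n : ℕ, ‖v ((n + 1 : ℕ) : ℤ)‖ ^ 2 ≤
      c * ‖v n‖ ^ 2 + c ^ 2 / (1 - c) * ‖e (n + 1)‖ ^ 2 := fun n => by
    have e1 : r * v ((n + 1 : ℕ) : ℤ) = v n - e (n + 1) := by
      simp [he]
    have e2 : ‖v ((n + 1 : ℕ) : ℤ)‖ ≤ c * (‖v n‖ + ‖e (n + 1)‖) := by
      have := norm_sub_le (v n) (e (n + 1))
      rw [← e1, norm_mul] at this
      rw [hc, one_div, ← div_eq_inv_mul, le_div_iff₀ hr0]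
      linarith
    have e3 : c ^ 2 * (‖v n‖ + ‖e (n + 1)‖) ^ 2 ≤
        c * ‖v n‖ ^ 2 + c ^ 2 / (1 - c) * ‖e (n + 1)‖ ^ 2 := by
      have e4 : c * ‖v n‖ ^ 2 + c ^ 2 / (1 - c) * ‖e (n + 1)‖ ^ 2 -
          c ^ 2 * (‖v n‖ + ‖e (n + 1)‖) ^ 2 =
          c / (1 - c) * ((1 - c) * ‖v n‖ - c * ‖e (n + 1)‖) ^ 2 := by
        field_simp
        ring
      have : 0 ≤ c / (1 - c) * ((1 - c) * ‖v n‖ - c * ‖e (n + 1)‖) ^ 2 := by positivity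
      linarith
    calc ‖v ((n + 1 : ℕ) : ℤ)‖ ^ 2 ≤ (c * (‖v n‖ + ‖e (n + 1)‖)) ^ 2 := by gcongr
      _ ≤ _ := by rw [mul_pow]; exact e3
  set A : ℝ := ‖v 0‖ ^ 2 * wt 0 + c ^ 2 / (1 - c) * ∑' n, ‖e n‖ ^ 2 * wt n with hA
  have hsum : ∀ N, ∑ n ∈ Finset.range N, ‖e (n + 1)‖ ^ 2 * wt (n + 1) ≤
      ∑' n, ‖e n‖ ^ 2 * wt n := fun N => by
    have := h.sum_le_tsum (Finset.range (N + 1)) fun n _ => mul_nonneg (sq_nonneg _) (hwt0 n)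
    rw [Finset.sum_range_succ'] at this
    have h0 : 0 ≤ ‖e 0‖ ^ 2 * wt 0 := mul_nonneg (sq_nonneg _) (hwt0 0)
    have h1 := (le_add_of_nonneg_right h0).trans this
    exact h1
  have hA0 : 0 ≤ A := by
    have : 0 ≤ ∑' n, ‖e n‖ ^ 2 * wt n := tsum_nonneg fun n => mul_nonneg (sq_nonneg _) (hwt0 n)
    have := hwt0 0
    positivity
  refine summable_of_sum_range_le (c := A / (1 - c)) (fun n => mul_nonneg (sq_nonneg _) (hwt0 n))
    fun N => ?_
  induction N with
  | zero => simp; positivity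
  | succ N ih =>
    rw [Finset.sum_range_succ']
    have h2 : ∑ n ∈ Finset.range N, ‖v ((n + 1 : ℕ) : ℤ)‖ ^ 2 * wt (n + 1) ≤
        c * ∑ n ∈ Finset.range N, ‖v n‖ ^ 2 * wt n +
          c ^ 2 / (1 - c) * ∑ n ∈ Finset.range N, ‖e (n + 1)‖ ^ 2 * wt (n + 1) := by
      rw [Finset.mul_sum, Finset.mul_sum, ← Finset.sum_add_distrib]
      refine Finset.sum_le_sum fun n _ => ?_
      have a1 := mul_le_mul_of_nonneg_right (hstep n) (hwt0 (n + 1))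
      have a2 : c * ‖v n‖ ^ 2 * wt (n + 1) ≤ c * ‖v n‖ ^ 2 * wt n :=
        mul_le_mul_of_nonneg_left (weight_antitone n.le_succ) (by positivity)
      linarith
    have h3 := mul_le_mul_of_nonneg_left ih hc0.le
    have h4 := mul_le_mul_of_nonneg_left (hsum N) (show 0 ≤ c ^ 2 / (1 - c) by positivity)
    have h5 : A / (1 - c) = A + c * (A / (1 - c)) := by field_simp; ring
    rw [h5]
    have h6 : A = ‖v ((0 : ℕ) : ℤ)‖ ^ 2 * wt 0 +
      c ^ 2 / (1 - c) * ∑' n, ‖e n‖ ^ 2 * wt n := by rw [hA]; simp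
    change ∑ n ∈ Finset.range N, ‖v ((n + 1 : ℕ) : ℤ)‖ ^ 2 * wt (n + 1) +
      ‖v ((0 : ℕ) : ℤ)‖ ^ 2 * wt 0 ≤ _
    change c * ∑ n ∈ Finset.range N, ‖v n‖ ^ 2 * wt n ≤ _ at h3
    linarith

/-- A polynomial in the backward shift without zeros in the closed unit disc is boundedly
invertible, up to initial conditions, in the weighted square-summable sense. -/
theorem summable_of_summable_aeval_backshift (Q : ℂ[X]) (hQ : ∀ z : ℂ, ‖z‖ ≤ 1 → Q.eval z ≠ 0)
    (v : ℤ → ℂ)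
    (h : Summable fun n : ℕ =>
      ‖aeval (backshift ℂ) Q v n‖ ^ 2 * ((n : ℝ) + 1) ^ (-(9 / 8) : ℝ)) :
    Summable fun n : ℕ => ‖v n‖ ^ 2 * ((n : ℝ) + 1) ^ (-(9 / 8) : ℝ) := by
  induction hd : Q.natDegree generalizing Q with
  | zero =>
    obtain ⟨c, rfl⟩ := natDegree_eq_zero.1 hd
    have hc : c ≠ 0 := by simpa using hQ 0 (by simp)
    have hc' : (‖c‖ ^ 2) ≠ 0 := by simpa using hc
    refine (summable_mul_left_iff hc').1 (h.congr fun n => ?_)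
    simp [mul_pow, mul_assoc]
  | succ d ih =>
    -- Linear factors are removed one at a time; each root lies outside the closed disc, so each
    -- factor can be inverted.
    obtain ⟨r, hr⟩ := IsAlgClosed.exists_root Q (by
      intro h0
      have h1 : Q.natDegree = 0 := natDegree_eq_of_degree_eq_some h0
      omega)
    have hr1 : 1 < ‖r‖ := by
      by_contra hle
      exact hQ r (not_lt.1 hle) hr
    obtain ⟨Q', rfl⟩ := dvd_iff_isRoot.2 hr
    have hQ' : Q' ≠ 0 := by
      rintro rfl
      simp at hd
    rw [natDegree_mul (X_sub_C_ne_zero r) hQ', natDegree_X_sub_C] at hd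
    refine ih Q' (fun z hz h0 => hQ z hz (by simp [h0])) ?_ (by omega)
    refine summable_of_summable_backshift_sub hr1 (h.congr fun n => ?_)
    rw [aeval_backshift_mul]
    simp

/-- The detour through ℂ is needed because the roots may be complex. -/
theorem weightedSqSummable_of_aeval_backshift (Q : ℝ[X])
    (hQ : ∀ z : ℂ, ‖z‖ ≤ 1 → aeval z Q ≠ 0) (v : ℤ → ℝ)
    (h : WeightedSqSummable fun n : ℕ => aeval (backshift ℝ) Q v n) :
    WeightedSqSummable fun n : ℕ => v n := by
  have h1 := summable_of_summable_aeval_backshift (Q.map (algebraMap ℝ ℂ))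
    (fun z hz => by rw [eval_map_algebraMap]; exact hQ z hz) (fun k => (v k : ℂ)) (by
      refine h.congr fun n => ?_
      have hd : (Q.map (algebraMap ℝ ℂ)).natDegree < Q.natDegree + 1 :=
        Nat.lt_succ_of_le natDegree_map_le
      dsimp only
      rw [aeval_backshift_apply (Nat.lt_succ_self Q.natDegree), aeval_backshift_apply hd]
      have e : ∑ m ∈ Finset.range (Q.natDegree + 1),
          (Q.map (algebraMap ℝ ℂ)).coeff m * ((v ((n : ℤ) - m) : ℝ) : ℂ) =
          ((∑ m ∈ Finset.range (Q.natDegree + 1), Q.coeff m * v ((n : ℤ) - m) : ℝ) : ℂ) := by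
        push_cast
        simp
      rw [e, Complex.norm_real, Real.norm_eq_abs, sq_abs])
  refine h1.congr fun n => ?_
  rw [Complex.norm_real, Real.norm_eq_abs, sq_abs]

end Backshift

/-! ### The system equation as polynomials in the shift -/

section HammersteinAlgebra

open Polynomial

variable {p q s : ℕ}

theorem aeval_inputPoly_apply (b : Fin q → ℝ) (t : ℤ → ℝ) (k : ℤ) :
    aeval (backshift ℝ) (inputPoly b) t k = ∑ i : Fin q, b i * t (k - (i : ℕ)) := by
  simp [inputPoly, map_sum, Finset.sum_apply]

theorem aeval_arPoly_apply (a : Fin p → ℝ) (t : ℤ → ℝ) (k : ℤ) :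
    aeval (backshift ℝ) (arPoly a) t k = t k - ∑ i : Fin p, a i * t (k - ((i : ℕ) + 1)) := by
  simp [arPoly, map_sum, Finset.sum_apply]

theorem natDegree_arPoly_le (a : Fin p → ℝ) : (arPoly a).natDegree ≤ p := by
  unfold arPoly
  refine (natDegree_sub_le _ _).trans (max_le (by simp) ?_)
  exact natDegree_sum_le_of_forall_le _ _ fun i _ => (natDegree_C_mul_X_pow_le _ _).trans i.2

theorem natDegree_inputPoly_lt (b : Fin q → ℝ) : (inputPoly b).natDegree < q + 1 := by
  unfold inputPoly
  refine Nat.lt_succ_of_le ?_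
  exact natDegree_sum_le_of_forall_le _ _ fun i _ => (natDegree_C_mul_X_pow_le _ _).trans i.2.le

/-- The direction `x` of the regressor, filtered by `A`, has the coefficients of this polynomial
in front of the lagged values of `g_j(u)`. -/
noncomputable def basisPoly (a : Fin p → ℝ) (b : Fin q → ℝ) (d : Fin s → ℝ)
    (x : Fin p ⊕ (Fin q × Fin s) → ℝ) (j : Fin s) : ℝ[X] :=
  C (d j) * (inputPoly (fun i => x (Sum.inl i)) * (X * inputPoly b)) +
    arPoly a * inputPoly fun i => x (Sum.inr (i, j))

theorem natDegree_basisPoly_lt (a : Fin p → ℝ) (b : Fin q → ℝ) (d : Fin s → ℝ)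
    (x : Fin p ⊕ (Fin q × Fin s) → ℝ) (j : Fin s) :
    (basisPoly a b d x j).natDegree < p + q + 2 := by
  have h1 := natDegree_inputPoly_lt (fun i => x (Sum.inl i))
  have h2 := natDegree_inputPoly_lt b
  have h3 := natDegree_arPoly_le a
  have h4 := natDegree_inputPoly_lt (fun i => x (Sum.inr (i, j)))
  refine Nat.lt_succ_of_le ((natDegree_add_le _ _).trans (max_le ?_ ?_))
  · refine (natDegree_C_mul_le _ _).trans (natDegree_mul_le.trans ?_)
    have := natDegree_mul_le (p := (X : ℝ[X])) (q := inputPoly b)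
    rw [natDegree_X] at this
    omega
  · refine natDegree_mul_le.trans ?_
    omega

theorem dotProduct_hammersteinRegressor (g : Fin s → ℝ → ℝ) (y u : ℤ → ℝ) (k : ℕ)
    (x : Fin p ⊕ (Fin q × Fin s) → ℝ) :
    x ⬝ᵥ hammersteinRegressor p q g y u k =
      aeval (backshift ℝ) (inputPoly fun i => x (Sum.inl i)) y k +
      ∑ j, aeval (backshift ℝ) (inputPoly fun i => x (Sum.inr (i, j))) (fun k => g j (u k)) k := by
  simp only [aeval_inputPoly_apply, dotProduct, Fintype.sum_sum_type, hammersteinRegressor,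
    Sum.elim_inl, Sum.elim_inr, Fintype.sum_prod_type]
  rw [Finset.sum_comm (s := (Finset.univ : Finset (Fin q)))]

/-- The first output governed by the equations has time 2, whence `2 ≤ k`; the factor `X` is the
one-step input delay. -/
theorem IsHammersteinPath.aeval_arPoly {a : Fin p → ℝ} {b : Fin q → ℝ} {d : Fin s → ℝ}
    {g : Fin s → ℝ → ℝ} {y u : ℤ → ℝ} {w : ℕ → ℝ} (h : IsHammersteinPath a b d g y u w)
    {k : ℤ} (hk : 2 ≤ k) :
    aeval (backshift ℝ) (arPoly a) y k =
      ∑ j, d j * aeval (backshift ℝ) (X * inputPoly b) (fun k => g j (u k)) k + w k.toNat := by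
  obtain ⟨n, rfl⟩ : ∃ n : ℕ, k = ((n + 1 : ℕ) : ℤ) + 1 := ⟨(k - 2).toNat, by push_cast; omega⟩
  have h1 := h (n + 1) (Nat.le_add_left 1 n)
  rw [aeval_arPoly_apply, h1]
  have h2 : ∀ i : ℕ, (((n + 1 : ℕ) : ℤ) + 1 - ((i : ℤ) + 1)) = ((n + 1 : ℕ) : ℤ) - (i : ℤ) :=
    fun i => by ring
  have h3 : (((n + 1 : ℕ) : ℤ) + 1).toNat = n + 1 + 1 := by omega
  simp only [h2, h3, aeval_backshift_mul, aeval_X, backshift_apply, aeval_inputPoly_apply]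
  have h4 : ∀ i : ℕ, ((n + 1 : ℕ) : ℤ) + 1 - 1 - (i : ℤ) = ((n + 1 : ℕ) : ℤ) - (i : ℤ) :=
    fun i => by ring
  simp only [h4, Finset.mul_sum]
  rw [Finset.sum_comm]
  have h5 : ∀ (i : Fin q) (j : Fin s), b i * (d j * g j (u (((n + 1 : ℕ) : ℤ) - (i : ℕ)))) =
      d j * (b i * g j (u (((n + 1 : ℕ) : ℤ) - (i : ℕ)))) := fun i j => by ring
  simp only [h5]
  ring

/-- The regressor direction `x`, filtered by `A`, is a moving average of the noise and of the
transformed inputs. -/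
theorem IsHammersteinPath.filtered_dotProduct {a : Fin p → ℝ} {b : Fin q → ℝ} {d : Fin s → ℝ}
    {g : Fin s → ℝ → ℝ} {y u : ℤ → ℝ} {w : ℕ → ℝ} (h : IsHammersteinPath a b d g y u w)
    (x : Fin p ⊕ (Fin q × Fin s) → ℝ) {k : ℕ} (hk : p + 2 ≤ k) :
    x ⬝ᵥ hammersteinRegressor p q g y u k -
        ∑ i : Fin p, a i * (x ⬝ᵥ hammersteinRegressor p q g y u (k - (i + 1))) =
      ∑ i : Fin p, x (Sum.inl i) * w (k - i) +
      ∑ m : Fin (p + q + 2), ∑ j, (basisPoly a b d x j).coeff m * g j (u ((k : ℤ) - (m : ℕ))) := by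
  set α : ℝ[X] := inputPoly fun i => x (Sum.inl i) with hα
  set t : ℤ → ℝ := aeval (backshift ℝ) α y + ∑ j, aeval (backshift ℝ)
    (inputPoly fun i => x (Sum.inr (i, j))) (fun k => g j (u k)) with ht
  have h1 : ∀ k : ℕ, x ⬝ᵥ hammersteinRegressor p q g y u k = t k := fun k => by
    rw [dotProduct_hammersteinRegressor, ht]
    simp [Finset.sum_apply, hα]
  have h2 : ∀ i : Fin p, ((k - (i + 1) : ℕ) : ℤ) = (k : ℤ) - ((i : ℕ) + 1) := fun i => by
    have := i.2
    omega
  simp only [h1, h2]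
  -- Polynomials in the shift commute, so `A` may be moved next to `y`, where the system equation
  -- applies.
  rw [← aeval_arPoly_apply, ht, map_add, map_sum, Pi.add_apply, Finset.sum_apply,
    ← aeval_backshift_mul, mul_comm, aeval_backshift_mul, hα, aeval_inputPoly_apply]
  have h3 : ∀ i : Fin p, x (Sum.inl i) * aeval (backshift ℝ) (arPoly a) y ((k : ℤ) - (i : ℕ)) =
      x (Sum.inl i) * ∑ j, d j * aeval (backshift ℝ) (X * inputPoly b) (fun k => g j (u k))
        ((k : ℤ) - (i : ℕ)) + x (Sum.inl i) * w (k - i) := fun i => by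
    have := i.2
    rw [h.aeval_arPoly (by omega), mul_add]
    congr 3
    omega
  simp only [h3]
  rw [Finset.sum_add_distrib, add_comm (∑ i : Fin p, _) (∑ i : Fin p, _), add_assoc]
  congr 1
  have h4 : ∑ i : Fin p, x (Sum.inl i) * ∑ j, d j * aeval (backshift ℝ) (X * inputPoly b)
      (fun k => g j (u k)) ((k : ℤ) - (i : ℕ)) =
      ∑ j, d j * aeval (backshift ℝ) (α * (X * inputPoly b)) (fun k => g j (u k)) k := by
    simp only [aeval_backshift_mul α]
    simp only [hα, aeval_inputPoly_apply, Finset.mul_sum]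
    rw [Finset.sum_comm]
    refine Finset.sum_congr rfl fun j _ => Finset.sum_congr rfl fun i _ => by ring
  rw [h4, ← Finset.sum_add_distrib, Finset.sum_comm]
  refine Finset.sum_congr rfl fun j _ => ?_
  rw [← aeval_backshift_mul, ← Finset.sum_range (fun m => (basisPoly a b d x j).coeff m *
    g j (u ((k : ℤ) - m))), ← aeval_backshift_apply (natDegree_basisPoly_lt a b d x j)
    (fun k => g j (u k)), basisPoly, map_add, LinearMap.add_apply,
    Pi.add_apply, aeval_backshift_mul (C (d j))]
  simp [hα]

end HammersteinAlgebra

/-! ### Directions invisible to the transformed inputs -/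

section Identifiability

open Polynomial

variable {p q s : ℕ}

theorem coeff_inputPoly (b : Fin q → ℝ) (i : Fin q) : (inputPoly b).coeff i = b i := by
  simp only [inputPoly, finsetSum_coeff, coeff_C_mul, coeff_X_pow]
  rw [Finset.sum_eq_single i]
  · simp
  · intro j _ hj
    simp [Fin.val_inj, hj.symm]
  · simp

theorem eq_zero_of_inputPoly_eq_zero {b : Fin q → ℝ} (h : inputPoly b = 0) : b = 0 := by
  ext i
  rw [← coeff_inputPoly b i, h]
  simp

theorem degree_inputPoly_lt (b : Fin q → ℝ) : (inputPoly b).degree < q :=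
  degree_sum_fin_lt b

theorem coeff_zero_arPoly (a : Fin p → ℝ) : (arPoly a).coeff 0 = 1 := by
  simp [arPoly]

theorem arPoly_ne_zero (a : Fin p → ℝ) : arPoly a ≠ 0 := fun h => by
  have := coeff_zero_arPoly a
  rw [h] at this
  simp at this

theorem eq_zero_of_basisPoly_eq_zero {a : Fin p → ℝ} {b : Fin q → ℝ} {d : Fin s → ℝ}
    {x : Fin p ⊕ (Fin q × Fin s) → ℝ} (hx : ∀ i, x (Sum.inl i) = 0)
    (h : ∀ j, basisPoly a b d x j = 0) : x = 0 := by
  have h0 : inputPoly (fun i => x (Sum.inl i)) = 0 := by simp [inputPoly, hx]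
  ext (i | ⟨i, j⟩)
  · exact hx i
  · have hj := h j
    rw [basisPoly, h0, zero_mul, mul_zero, zero_add] at hj
    have h1 := (mul_eq_zero.1 hj).resolve_left (arPoly_ne_zero a)
    exact congrFun (eq_zero_of_inputPoly_eq_zero h1) i

/-- For `d j ≠ 0` the hypothesis reads `d j · α · X B = -A β`. As `A` has constant coefficient 1, it
is coprime to `X B`, so `A ∣ α` and `X B ∣ β`. If `A` has degree `p`, then `α` is too short for `A`;
if `X B` has degree `q`, then `β` is too short for `X B`. Either way `α = 0`, and then `A` cancels
from every remaining equation. -/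
theorem MinimalSystem.eq_zero_of_basisPoly_eq_zero {a : Fin p → ℝ} {b : Fin q → ℝ} {d : Fin s → ℝ}
    (hmin : MinimalSystem a b d) (hb : ∑ i, b i ^ 2 ≠ 0) {x : Fin p ⊕ (Fin q × Fin s) → ℝ}
    (h : ∀ j, basisPoly a b d x j = 0) : x = 0 := by
  obtain ⟨hcop, hdeg, hd⟩ := hmin
  obtain ⟨j, hj⟩ := Function.ne_iff.1 hd
  have hj : d j ≠ 0 := hj
  have hB : inputPoly b ≠ 0 := fun h0 => hb (by simp [eq_zero_of_inputPoly_eq_zero h0])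
  have hXA : IsCoprime (arPoly a) X := by
    refine IsCoprime.symm ((irreducible_X.coprime_iff_not_dvd).2 ?_)
    rw [X_dvd_iff, coeff_zero_arPoly]
    exact one_ne_zero
  have hcop' : IsCoprime (arPoly a) (X * inputPoly b) := hXA.mul_right hcop
  set α : ℝ[X] := inputPoly fun i => x (Sum.inl i) with hα
  set β : ℝ[X] := inputPoly fun i => x (Sum.inr (i, j)) with hβ
  have hunit : IsUnit (C (d j) : ℝ[X]) := isUnit_C.2 hj.isUnit
  have heq : C (d j) * (α * (X * inputPoly b)) = -(arPoly a * β) := by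
    have := h j
    rw [basisPoly] at this
    exact eq_neg_of_add_eq_zero_left this
  have hα0 : α = 0 := by
    rcases hdeg with hdeg | hdeg
    · have h1 : arPoly a ∣ α := by
        have h2 : arPoly a ∣ C (d j) * (α * (X * inputPoly b)) := by
          rw [heq]; exact (dvd_mul_right _ _).neg_right
        exact hcop'.dvd_of_dvd_mul_right ((hunit.dvd_mul_left).1 h2)
      exact eq_zero_of_dvd_of_degree_lt h1
        ((degree_inputPoly_lt _).trans_le (le_degree_of_ne_zero hdeg))
    · have h1 : X * inputPoly b ∣ β := by
        have h2 : X * inputPoly b ∣ arPoly a * β := by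
          rw [← dvd_neg, ← heq]
          exact (dvd_mul_left _ _).mul_left _
        exact hcop'.symm.dvd_of_dvd_mul_left h2
      have hβ0 : β = 0 := eq_zero_of_dvd_of_degree_lt h1
        ((degree_inputPoly_lt _).trans_le (le_degree_of_ne_zero hdeg))
      rw [hβ0, mul_zero, neg_zero] at heq
      have h3 := (mul_eq_zero.1 heq).resolve_left hunit.ne_zero
      exact (mul_eq_zero.1 h3).resolve_right (mul_ne_zero X_ne_zero hB)
  exact _root_.eq_zero_of_basisPoly_eq_zero
    (fun i => congrFun (eq_zero_of_inputPoly_eq_zero hα0) i) h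

/-- The coefficients of the filtered regressor direction, as a linear function of the direction. -/
noncomputable def basisCoeff (a : Fin p → ℝ) (b : Fin q → ℝ) (d : Fin s → ℝ) (m : ℕ) (j : Fin s) :
    (Fin p ⊕ (Fin q × Fin s) → ℝ) →ₗ[ℝ] ℝ where
  toFun x := (basisPoly a b d x j).coeff m
  map_add' x x' := by
    have h : ∀ {n : ℕ} (c c' : Fin n → ℝ),
        inputPoly (fun i => c i + c' i) = inputPoly c + inputPoly c' := fun c c' => by
      simp [inputPoly, add_mul, Finset.sum_add_distrib]
    simp only [basisPoly, Pi.add_apply, h, ← coeff_add]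
    congr 1
    ring
  map_smul' t x := by
    have h : ∀ {n : ℕ} (c : Fin n → ℝ), inputPoly (fun i => t * c i) = C t * inputPoly c :=
      fun c => by simp [inputPoly, Finset.mul_sum, mul_assoc]
    simp only [basisPoly, Pi.smul_apply, smul_eq_mul, h, RingHom.id_apply, ← coeff_C_mul]
    congr 1
    ring

end Identifiability

/-! ### From limiting second moments to uniform excitation -/

section QuadraticForms

variable {ι : Type*} [Fintype ι]

theorem norm_sq_le_sum_sq (x : ι → ℝ) : ‖x‖ ^ 2 ≤ ∑ l, x l ^ 2 := by
  have h0 : 0 ≤ ∑ l, x l ^ 2 := Finset.sum_nonneg fun _ _ => sq_nonneg _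
  rw [← Real.le_sqrt (norm_nonneg _) h0, pi_norm_le_iff_of_nonneg (Real.sqrt_nonneg _)]
  intro l
  rw [Real.norm_eq_abs, ← Real.sqrt_sq_eq_abs]
  exact Real.sqrt_le_sqrt
    (Finset.single_le_sum (f := fun l => x l ^ 2) (fun _ _ => sq_nonneg _) (Finset.mem_univ l))

theorem sum_sq_le_card_mul_norm_sq (x : ι → ℝ) :
    ∑ l, x l ^ 2 ≤ (Fintype.card ι : ℝ) * ‖x‖ ^ 2 := by
  have : ∀ l ∈ Finset.univ, x l ^ 2 ≤ ‖x‖ ^ 2 := fun l _ => by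
    rw [← sq_abs, ← Real.norm_eq_abs]
    gcongr
    exact norm_le_pi_norm x l
  simpa using Finset.sum_le_card_nsmul _ _ _ this

/-- A positive definite quadratic function dominates a multiple of the sum of squares. -/
theorem exists_pos_mul_sum_sq_le {Q : (ι → ℝ) → ℝ} (hc : Continuous Q)
    (hh : ∀ (t : ℝ) x, Q (t • x) = t ^ 2 * Q x) (hpos : ∀ x, x ≠ 0 → 0 < Q x) :
    ∃ c : ℝ, 0 < c ∧ ∀ x, c * ∑ l, x l ^ 2 ≤ Q x := by
  obtain ⟨m, hm, hmQ⟩ : ∃ m : ℝ, 0 < m ∧ ∀ x ∈ Metric.sphere (0 : ι → ℝ) 1, m ≤ Q x := by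
    -- The unit sphere is empty when `ι` is; otherwise compactness gives a positive minimum.
    rcases (Metric.sphere (0 : ι → ℝ) 1).eq_empty_or_nonempty with he | hne
    · exact ⟨1, one_pos, by simp [he]⟩
    · obtain ⟨x₀, hx₀, hmin⟩ := (isCompact_sphere (0 : ι → ℝ) 1).exists_isMinOn hne hc.continuousOn
      refine ⟨Q x₀, hpos _ ?_, fun x hx => hmin hx⟩
      rintro rfl
      simp at hx₀
  refine ⟨m / (Fintype.card ι + 1), by positivity, fun x => ?_⟩
  rcases eq_or_ne x 0 with rfl | hx
  · have := hh 0 0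
    simp at this
    simp [this]
  · have hn : 0 < ‖x‖ := norm_pos_iff.2 hx
    have h1 : m ≤ Q (‖x‖⁻¹ • x) := hmQ _ (by simp [norm_smul, hn.ne'])
    have h2 : Q x = ‖x‖ ^ 2 * Q (‖x‖⁻¹ • x) := by
      rw [← hh, smul_smul, mul_inv_cancel₀ hn.ne', one_smul]
    rw [h2, div_mul_eq_mul_div, div_le_iff₀ (by positivity)]
    calc m * ∑ l, x l ^ 2 ≤ m * ((Fintype.card ι : ℝ) * ‖x‖ ^ 2) := by
          gcongr; exact sum_sq_le_card_mul_norm_sq x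
      _ ≤ m * ((Fintype.card ι + 1 : ℝ) * ‖x‖ ^ 2) := by gcongr; linarith
      _ ≤ Q (‖x‖⁻¹ • x) * ((Fintype.card ι + 1 : ℝ) * ‖x‖ ^ 2) := by gcongr
      _ = _ := by ring

/-- If the empirical second moments of `η` are asymptotically at least `R` (with equality off the
diagonal) and `R` is positive definite along the linear map `L`, then the directions `L x` are
uniformly excited. -/
theorem exists_excitation_of_moments {I : Type*} [Fintype I]
    (L : (ι → ℝ) →ₗ[ℝ] (I → ℝ)) (η : I → ℕ → ℝ) (R : I → I → ℝ)
    (hpos : ∀ x, x ≠ 0 → 0 < ∑ c, ∑ c', L x c * L x c' * R c c')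
    (hoff : ∀ c c', c ≠ c' →
      Tendsto (fun N : ℕ => (∑ n ∈ Finset.range N, η c n * η c' n) / N) atTop (nhds (R c c')))
    (hdiag : ∀ c, ∀ δ : ℝ, 0 < δ → ∀ᶠ N : ℕ in atTop,
      (R c c - δ) * N ≤ ∑ n ∈ Finset.range N, η c n ^ 2) :
    ∃ c : ℝ, 0 < c ∧ ∀ᶠ N : ℕ in atTop, ∀ x : ι → ℝ,
      c * N * ∑ l, x l ^ 2 ≤ ∑ n ∈ Finset.range N, (∑ c, L x c * η c n) ^ 2 := by
  have hLc : Continuous L := L.continuous_of_finiteDimensional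
  have hLc' : ∀ c, Continuous fun x => L x c := fun c => (continuous_apply c).comp hLc
  obtain ⟨c₀, hc₀, hQ⟩ := exists_pos_mul_sum_sq_le
    (Q := fun x => ∑ c, ∑ c', L x c * L x c' * R c c')
    (by fun_prop) (fun t x => by
      simp only [map_smul, Pi.smul_apply, smul_eq_mul, Finset.mul_sum]
      exact Finset.sum_congr rfl fun _ _ => Finset.sum_congr rfl fun _ _ => by ring) hpos
  obtain ⟨K, hK0, hK⟩ : ∃ K : ℝ, 0 < K ∧ ∀ x, (∑ c, |L x c|) ^ 2 ≤ K * ∑ l, x l ^ 2 := by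
    set L' : (ι → ℝ) →L[ℝ] (I → ℝ) := LinearMap.toContinuousLinearMap L with hL'
    refine ⟨(Fintype.card I * ‖L'‖) ^ 2 + 1, by positivity, fun x => ?_⟩
    have h1 : ∀ c ∈ Finset.univ, |L x c| ≤ ‖L'‖ * ‖x‖ := fun c _ =>
      (norm_le_pi_norm (L x) c).trans (L'.le_opNorm x)
    have h2 : ∑ c, |L x c| ≤ Fintype.card I * (‖L'‖ * ‖x‖) := by
      simpa using Finset.sum_le_card_nsmul _ _ _ h1
    have h3 : 0 ≤ ∑ c, |L x c| := Finset.sum_nonneg fun _ _ => abs_nonneg _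
    calc (∑ c, |L x c|) ^ 2 ≤ (Fintype.card I * (‖L'‖ * ‖x‖)) ^ 2 := by gcongr
      _ = (Fintype.card I * ‖L'‖) ^ 2 * ‖x‖ ^ 2 := by ring
      _ ≤ ((Fintype.card I * ‖L'‖) ^ 2 + 1) * ‖x‖ ^ 2 := by gcongr; linarith
      _ ≤ _ := by gcongr; exact norm_sq_le_sum_sq x
  -- Entrywise errors `δ` cost at most `δ (∑ |L x c|)² ≤ δ K ∑ x²`, which is half of the available
  -- `c₀ ∑ x²`.
  set δ : ℝ := c₀ / (2 * K) with hδ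
  have hδ0 : 0 < δ := by positivity
  have hev : ∀ c c', ∀ᶠ N : ℕ in atTop, ∀ l : I → ℝ,
      (l c * l c' * R c c' - δ * (|l c| * |l c'|)) * N ≤
        l c * l c' * ∑ n ∈ Finset.range N, η c n * η c' n := by
    intro c c'
    -- Diagonal terms carry the nonnegative factor `l c ^ 2`, so a lower bound suffices there; the
    -- noise energy need not have a limit.
    by_cases hcc : c = c'
    · subst hcc
      filter_upwards [hdiag c δ hδ0] with N hN l
      have h1 := mul_le_mul_of_nonneg_left hN (mul_self_nonneg (l c))
      simp only [← pow_two, sq_abs] at h1 ⊢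
      refine le_trans (le_of_eq ?_) h1
      ring
    · filter_upwards [(Metric.tendsto_nhds.1 (hoff c c' hcc)) δ hδ0, eventually_gt_atTop 0]
        with N hN hN0 l
      have hN0' : (0 : ℝ) < N := by exact_mod_cast hN0
      rw [Real.dist_eq] at hN
      set T : ℝ := ∑ n ∈ Finset.range N, η c n * η c' n with hT
      have h2 : |l c * l c' * (T / N - R c c')| ≤ δ * (|l c| * |l c'|) := by
        rw [abs_mul, abs_mul, mul_comm δ]
        gcongr
      have h3 := neg_le_of_abs_le h2
      have h4 : l c * l c' * R c c' - δ * (|l c| * |l c'|) ≤ l c * l c' * (T / N) := by linarith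
      calc _ ≤ l c * l c' * (T / N) * N := mul_le_mul_of_nonneg_right h4 hN0'.le
        _ = l c * l c' * T := by field_simp
  refine ⟨c₀ / 2, by positivity, ?_⟩
  filter_upwards [eventually_all.2 fun c => eventually_all.2 fun c' => hev c c'] with N hN x
  have e1 : ∑ n ∈ Finset.range N, (∑ c, L x c * η c n) ^ 2 =
      ∑ c, ∑ c', L x c * L x c' * ∑ n ∈ Finset.range N, η c n * η c' n := by
    simp only [pow_two, Finset.sum_mul_sum]
    rw [Finset.sum_comm]
    refine Finset.sum_congr rfl fun c _ => ?_
    rw [Finset.sum_comm]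
    refine Finset.sum_congr rfl fun c' _ => ?_
    rw [Finset.mul_sum]
    exact Finset.sum_congr rfl fun n _ => by ring
  have e2 : ∑ c, ∑ c', (L x c * L x c' * R c c' - δ * (|L x c| * |L x c'|)) * N =
      (∑ c, ∑ c', L x c * L x c' * R c c' - δ * (∑ c, |L x c|) ^ 2) * N := by
    simp only [← Finset.sum_mul, Finset.sum_sub_distrib, ← Finset.mul_sum, pow_two]
  rw [e1]
  refine le_trans ?_ (Finset.sum_le_sum fun c _ => Finset.sum_le_sum fun c' _ => hN c c' (L x))
  rw [e2]
  have h1 := hQ x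
  have h2 := mul_le_mul_of_nonneg_left (hK x) hδ0.le
  have h3 : δ * (K * ∑ l, x l ^ 2) = c₀ / 2 * ∑ l, x l ^ 2 := by
    rw [hδ]; field_simp
  have h4 : c₀ / 2 * ∑ l, x l ^ 2 ≤
      ∑ c, ∑ c', L x c * L x c' * R c c' - δ * (∑ c, |L x c|) ^ 2 := by linarith
  have h5 := mul_le_mul_of_nonneg_right h4 (Nat.cast_nonneg (α := ℝ) N)
  linarith

end QuadraticForms

/-! ### Excitation passes back through the filter -/

section Filtering

theorem sum_range_add_le_sum_Icc {f : ℕ → ℝ} (hf : ∀ n, 0 ≤ f n) {m K : ℕ} (hm : 1 ≤ m)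
    (hmK : m ≤ K) (N : ℕ) :
    ∑ n ∈ Finset.range N, f (n + m) ≤ ∑ k ∈ Finset.Icc 1 (N + K), f k := by
  rw [Finset.range_eq_Ico, Finset.sum_Ico_add']
  refine Finset.sum_le_sum_of_subset_of_nonneg (fun k hk => ?_) fun k _ _ => hf k
  simp only [Finset.mem_Ico, Finset.mem_Icc] at hk ⊢
  omega

/-- A finite autoregressive filter is bounded in mean square. -/
theorem sum_sq_filtered_le {p K : ℕ} (a : Fin p → ℝ) (hK : p + 1 ≤ K) (t : ℕ → ℝ) (N : ℕ) :
    ∑ n ∈ Finset.range N, (t (n + K) - ∑ i : Fin p, a i * t (n + K - (i + 1))) ^ 2 ≤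
      (2 + 2 * (∑ i, a i ^ 2) * p) * ∑ k ∈ Finset.Icc 1 (N + K), t k ^ 2 := by
  set T : ℝ := ∑ k ∈ Finset.Icc 1 (N + K), t k ^ 2 with hT
  have ha : 0 ≤ ∑ i, a i ^ 2 := Finset.sum_nonneg fun _ _ => sq_nonneg _
  have h1 : ∀ n, (t (n + K) - ∑ i : Fin p, a i * t (n + K - (i + 1))) ^ 2 ≤
      2 * t (n + K) ^ 2 + 2 * (∑ i, a i ^ 2) * ∑ i : Fin p, t (n + K - (i + 1)) ^ 2 := fun n => by
    have h2 := Finset.sum_mul_sq_le_sq_mul_sq Finset.univ a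
      (fun i : Fin p => t (n + K - (i + 1)))
    nlinarith [sq_nonneg (t (n + K) + ∑ i : Fin p, a i * t (n + K - (i + 1)))]
  refine (Finset.sum_le_sum fun n _ => h1 n).trans ?_
  rw [Finset.sum_add_distrib, ← Finset.mul_sum, ← Finset.mul_sum, Finset.sum_comm, add_mul]
  have h3 : ∑ n ∈ Finset.range N, t (n + K) ^ 2 ≤ T :=
    sum_range_add_le_sum_Icc (f := fun k => t k ^ 2) (fun _ => sq_nonneg _) (by omega) le_rfl N
  have h4 : ∑ i : Fin p, ∑ n ∈ Finset.range N, t (n + K - (i + 1)) ^ 2 ≤ p * T := by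
    have : ∀ i ∈ (Finset.univ : Finset (Fin p)),
        ∑ n ∈ Finset.range N, t (n + K - (i + 1)) ^ 2 ≤ T := fun i _ => by
      have hi := i.2
      have e : ∀ n, n + K - ((i : ℕ) + 1) = n + (K - (i + 1)) := fun n => by omega
      simp only [e]
      exact sum_range_add_le_sum_Icc (f := fun k => t k ^ 2) (fun _ => sq_nonneg _) (by omega)
        (by omega) N
    simpa using Finset.sum_le_card_nsmul _ _ _ this
  have h5 := mul_le_mul_of_nonneg_left h4 (show 0 ≤ 2 * ∑ i, a i ^ 2 by positivity)
  linarith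

/-- The energy of the filtered signal is at most a constant times that of the signal, so `A` need
not be inverted. The loss of `K` initial terms is paid for by `N - K ≥ N / 2`. -/
theorem exists_excitation_of_filtered {ι : Type*} [Fintype ι] {p K : ℕ} (a : Fin p → ℝ)
    (hK : p + 1 ≤ K) (φ : ℕ → ι → ℝ)
    (h : ∃ c : ℝ, 0 < c ∧ ∀ᶠ N : ℕ in atTop, ∀ x : ι → ℝ, c * N * ∑ l, x l ^ 2 ≤
      ∑ n ∈ Finset.range N,
        (x ⬝ᵥ φ (n + K) - ∑ i : Fin p, a i * (x ⬝ᵥ φ (n + K - (i + 1)))) ^ 2) :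
    ∃ c : ℝ, 0 < c ∧ ∀ᶠ N : ℕ in atTop, ∀ x : ι → ℝ,
      c * N * ∑ l, x l ^ 2 ≤ ∑ k ∈ Finset.Icc 1 N, (x ⬝ᵥ φ k) ^ 2 := by
  obtain ⟨c, hc, hev⟩ := h
  have ha : 0 ≤ ∑ i, a i ^ 2 := Finset.sum_nonneg fun _ _ => sq_nonneg _
  set B : ℝ := 2 + 2 * (∑ i, a i ^ 2) * p with hB
  have hB0 : 0 < B := by positivity
  refine ⟨c / (2 * B), by positivity, ?_⟩
  filter_upwards [(tendsto_sub_atTop_nat K).eventually hev, eventually_ge_atTop (2 * K)]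
    with N hN hN2 x
  have h1 := (hN x).trans (sum_sq_filtered_le a hK (fun k => x ⬝ᵥ φ k) (N - K))
  rw [Nat.sub_add_cancel (by omega), Nat.cast_sub (by omega)] at h1
  have h2 : (2 * K : ℝ) ≤ N := by exact_mod_cast hN2
  have h3 : 0 ≤ ∑ l, x l ^ 2 := Finset.sum_nonneg fun _ _ => sq_nonneg _
  have h4 : c * (N / 2) * ∑ l, x l ^ 2 ≤ c * (N - K) * ∑ l, x l ^ 2 := by
    gcongr
    linarith
  have h5 : c / (2 * B) * N * ∑ l, x l ^ 2 = (c * (N / 2) * ∑ l, x l ^ 2) / B := by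
    field_simp
  rw [h5, div_le_iff₀ hB0]
  linarith

end Filtering

/-! ### Noise and input as martingale differences -/

section Shift

variable {Ω : Type*} {mΩ : MeasurableSpace Ω}

/-- The filtration `n ↦ ℱ (n + m)`. -/
def shiftFiltration (ℱ : Filtration ℕ mΩ) (m : ℕ) : Filtration ℕ mΩ where
  seq n := ℱ (n + m)
  mono' _ _ h := ℱ.mono (Nat.add_le_add_right h m)
  le' n := ℱ.le (n + m)

theorem tendsto_div_of_abs_le_rpow {S : ℕ → ℝ} {C : ℝ}
    (h : ∀ N : ℕ, |S N| ≤ C * (N : ℝ) ^ (9 / 16 : ℝ)) :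
    Tendsto (fun N : ℕ => S N / N) atTop (nhds 0) := by
  have h1 : Tendsto (fun N : ℕ => C * (N : ℝ) ^ (-(7 / 16) : ℝ)) atTop (nhds 0) := by
    have := ((tendsto_rpow_neg_atTop (show (0 : ℝ) < 7 / 16 by norm_num)).comp
      tendsto_natCast_atTop_atTop).const_mul C
    rwa [mul_zero] at this
  refine squeeze_zero_norm' ?_ h1
  filter_upwards [eventually_gt_atTop 0] with N hN
  have hN0 : (0 : ℝ) < N := by exact_mod_cast hN
  rw [norm_div, Real.norm_eq_abs, Real.norm_natCast, div_le_iff₀ hN0]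
  refine (h N).trans (le_of_eq ?_)
  rw [mul_assoc, ← Real.rpow_add_one hN0.ne']
  norm_num

end Shift

section Noise

open scoped ENNReal

variable {Ω : Type*} {mΩ : MeasurableSpace Ω} {P : Measure Ω} [IsProbabilityMeasure P]
  {ℱ : Filtration ℕ mΩ} {w : ℕ → Ω → ℝ}

/-- Since `γ > 2`, one has x² ≤ 1 + |x|^γ, so `1` plus the conditional γ-th moment dominates the
conditional variance. -/
theorem MartingaleDifferenceNoise.exists_isBoundedVarianceMDS
    (hw : MartingaleDifferenceNoise P ℱ w) {m : ℕ} (hm : 1 ≤ m) :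
    ∃ σ, IsBoundedVarianceMDS P (shiftFiltration ℱ m) (fun n => w (n + m + 1)) σ := by
  obtain ⟨hmeas, hint, γ, hγ, hsup⟩ := hw
  refine ⟨fun n ω => 1 + condLExp (ℱ (n + m)) P
    (fun ω' => ENNReal.ofReal (|w (n + m + 1) ω'| ^ γ)) ω, ?_⟩
  have hmeas' : ∀ n, Measurable (w (n + m + 1)) := fun n =>
    (hmeas (n + m + 1) (by omega)).mono (ℱ.le _) le_rfl
  refine ⟨fun n => ?_, fun n => (hint (n + m) (by omega)).1, fun n => (hint (n + m) (by omega)).2,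
    fun n => (measurable_condLExp _ _ _).const_add 1, fun n A hA => ?_, ?_⟩
  · have := hmeas (n + m + 1) (by omega)
    rwa [show n + m + 1 = n + 1 + m by ring] at this ⊢
  · rw [lintegral_add_left measurable_const]
    have e : ∫⁻ ω in A, condLExp (ℱ (n + m)) P
        (fun ω' => ENNReal.ofReal (|w (n + m + 1) ω'| ^ γ)) ω ∂P =
        ∫⁻ ω in A, ENNReal.ofReal (|w (n + m + 1) ω| ^ γ) ∂P :=
      setLIntegral_condLExp (hm := ℱ.le (n + m)) P _ hA
    rw [e, ← lintegral_add_left measurable_const]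
    refine lintegral_mono fun ω => ?_
    rw [← ENNReal.ofReal_one, ← ENNReal.ofReal_add zero_le_one (by positivity)]
    refine ENNReal.ofReal_le_ofReal ?_
    have h0 : 0 ≤ |w (n + m + 1) ω| := abs_nonneg _
    rw [← sq_abs]
    rcases le_total (|w (n + m + 1) ω|) 1 with h1 | h1
    · have : 0 ≤ |w (n + m + 1) ω| ^ γ := by positivity
      nlinarith
    · have := Real.rpow_le_rpow_of_exponent_le h1 hγ.le
      rw [Real.rpow_two] at this
      linarith
  · filter_upwards [hsup] with ω hω
    obtain ⟨M, hM⟩ := ENNReal.exists_nat_gt hω.ne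
    refine ⟨1 + M, fun n => ?_⟩
    push_cast
    gcongr
    refine le_trans ?_ hM.le
    exact le_iSup₂ (f := fun (k : ℕ) (_ : 1 ≤ k) => condLExp (ℱ k) P
      (fun ω' => ENNReal.ofReal (|w (k + 1) ω'| ^ γ)) ω) (n + m) (by omega)

end Noise

section Input

open scoped ENNReal

variable {Ω : Type*} {mΩ : MeasurableSpace Ω} {P : Measure Ω}

/-- The sets `A ∩ B` form a π-system generating `m₂ ⊔ m₃`, and on them the two hypotheses factor the
probability. -/
theorem Indep.sup_right_of_sup_left {m₁ m₂ m₃ : MeasurableSpace Ω} [IsProbabilityMeasure P]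
    (h₁ : m₁ ≤ mΩ) (h₂ : m₂ ≤ mΩ) (h₃ : m₃ ≤ mΩ) (h : Indep m₁ m₂ P)
    (h' : Indep (m₁ ⊔ m₂) m₃ P) : Indep m₁ (m₂ ⊔ m₃) P := by
  set p : Set (Set Ω) := {S | ∃ A B, MeasurableSet[m₂] A ∧ MeasurableSet[m₃] B ∧ S = A ∩ B} with hp
  have hpi : IsPiSystem p := by
    rintro _ ⟨A, B, hA, hB, rfl⟩ _ ⟨A', B', hA', hB', rfl⟩ _
    exact ⟨A ∩ A', B ∩ B', @MeasurableSet.inter _ m₂ _ _ hA hA',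
      @MeasurableSet.inter _ m₃ _ _ hB hB', Set.inter_inter_inter_comm _ _ _ _⟩
  have hgen : m₂ ⊔ m₃ = MeasurableSpace.generateFrom p := by
    refine le_antisymm (sup_le (fun A hA => ?_) (fun B hB => ?_))
      (MeasurableSpace.generateFrom_le ?_)
    · exact MeasurableSpace.measurableSet_generateFrom
        ⟨A, Set.univ, hA, @MeasurableSet.univ _ m₃, by simp⟩
    · exact MeasurableSpace.measurableSet_generateFrom
        ⟨Set.univ, B, @MeasurableSet.univ _ m₂, hB, by simp⟩
    · rintro _ ⟨A, B, hA, hB, rfl⟩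
      exact @MeasurableSet.inter _ (m₂ ⊔ m₃) _ _
        ((le_sup_left : m₂ ≤ m₂ ⊔ m₃) _ hA) ((le_sup_right : m₃ ≤ m₂ ⊔ m₃) _ hB)
  refine IndepSets.indep h₁ (sup_le h₂ h₃) (@MeasurableSpace.isPiSystem_measurableSet _ m₁) hpi
    (@MeasurableSpace.generateFrom_measurableSet _ m₁).symm hgen ?_
  rw [IndepSets_iff]
  rintro S _ hS ⟨A, B, hA, hB, rfl⟩
  rw [Indep_iff] at h h'
  have hA' : MeasurableSet[m₁ ⊔ m₂] A := (le_sup_right : m₂ ≤ m₁ ⊔ m₂) _ hA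
  have hS' : MeasurableSet[m₁ ⊔ m₂] S := (le_sup_left : m₁ ≤ m₁ ⊔ m₂) _ hS
  rw [← Set.inter_assoc, h' _ _ (@MeasurableSet.inter _ (m₁ ⊔ m₂) _ _ hS' hA') hB, h _ _ hS hA,
    h' _ _ hA' hB, mul_assoc]

variable {U : ℕ → Ω → ℝ} {V : Ω → ℕ → ℝ}

/-- The filtration generated by the whole of `V` and the values `U 0, …, U (n - 1)`. -/
def inputFiltration (hU : ∀ n, Measurable (U n)) (hV : Measurable V) : Filtration ℕ mΩ where
  seq n := (⨆ j ∈ Set.Iio n, MeasurableSpace.comap (U j) inferInstance) ⊔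
    MeasurableSpace.comap V inferInstance
  mono' _ _ h := sup_le_sup_right (biSup_mono fun _ hj => lt_of_lt_of_le hj h) _
  le' _ := sup_le (iSup₂_le fun j _ => (hU j).comap_le) hV.comap_le

theorem measurable_inputFiltration_input (hU : ∀ n, Measurable (U n)) (hV : Measurable V)
    {j n : ℕ} (h : j < n) : Measurable[inputFiltration hU hV n] (U j) := by
  refine Measurable.mono (comap_measurable (U j)) ?_ le_rfl
  exact (le_iSup₂ (f := fun j (_ : j ∈ Set.Iio n) =>
    MeasurableSpace.comap (U j) inferInstance) j h).trans le_sup_left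

theorem measurable_inputFiltration_aux (hU : ∀ n, Measurable (U n)) (hV : Measurable V)
    (k n : ℕ) : Measurable[inputFiltration hU hV n] (fun ω => V ω k) := by
  refine Measurable.mono ((measurable_pi_apply k).comp (comap_measurable V)) ?_ le_rfl
  exact le_sup_right

theorem indep_inputFiltration [IsProbabilityMeasure P] (hU : ∀ n, Measurable (U n))
    (hV : Measurable V) (hiid : iIndepFun U P) (hUV : IndepFun (fun ω k => U k ω) V P) (n : ℕ) :
    Indep (MeasurableSpace.comap (U n) inferInstance) (inputFiltration hU hV n) P := by
  have h1 : Indep (⨆ j ∈ ({n} : Set ℕ), MeasurableSpace.comap (U j) inferInstance)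
      (⨆ j ∈ Set.Iio n, MeasurableSpace.comap (U j) inferInstance) P :=
    indep_iSup_of_disjoint (fun j => (hU j).comap_le) hiid (by simp)
  rw [iSup_singleton] at h1
  refine Indep.sup_right_of_sup_left (hU n).comap_le (iSup₂_le fun j _ => (hU j).comap_le)
    hV.comap_le h1 ?_
  refine indep_of_indep_of_le_left hUV ?_
  have h2 : ∀ j, MeasurableSpace.comap (U j) inferInstance ≤
      MeasurableSpace.comap (fun ω k => U k ω) (inferInstance : MeasurableSpace (ℕ → ℝ)) := by
    intro j
    have : U j = (fun v : ℕ → ℝ => v j) ∘ fun ω k => U k ω := rfl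
    rw [this, ← MeasurableSpace.comap_comp]
    exact MeasurableSpace.comap_mono (measurable_pi_apply j).comap_le
  exact sup_le (h2 n) (iSup₂_le fun j _ => h2 j)

/-- By independence the conditional variance is constant. The filtration contains all of `V`, so
noise values at any time, even future ones, serve as predictable factors. -/
theorem isBoundedVarianceMDS_input [IsProbabilityMeasure P] (hU : ∀ n, Measurable (U n))
    (hV : Measurable V) (hiid : iIndepFun U P) (hUV : IndepFun (fun ω k => U k ω) V P)
    {μ : Measure ℝ} (hlaw : ∀ n, P.map (U n) = μ) {h : ℝ → ℝ} (hh : Measurable h)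
    (hh2 : MemLp h 2 μ) (hmean : ∫ x, h x ∂μ = 0) (m : ℕ) :
    IsBoundedVarianceMDS P (shiftFiltration (inputFiltration hU hV) m)
      (fun n ω => h (U (n + m) ω)) (fun _ _ => ∫⁻ x, ENNReal.ofReal (h x ^ 2) ∂μ) := by
  have : IsProbabilityMeasure μ := by
    rw [← hlaw 0]; exact Measure.isProbabilityMeasure_map (hU 0).aemeasurable
  have hint : ∀ n, Integrable (fun ω => h (U n ω)) P := fun n => by
    have := hh2.integrable one_le_two
    rw [← hlaw n] at this
    exact this.comp_measurable (hU n)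
  refine ⟨fun n => ?_, fun n => hint _, fun n => ?_, fun n => measurable_const, fun n A hA => ?_, ?_⟩
  · exact hh.comp (measurable_inputFiltration_input hU hV (by omega))
  · refine (condExp_indep_eq (hU (n + m)).comap_le ((inputFiltration hU hV).le (n + m))
      (hh.comp (comap_measurable (U (n + m)))).stronglyMeasurable
      (indep_inputFiltration hU hV hiid hUV (n + m))).trans ?_
    refine ae_of_all _ fun ω => ?_
    change ∫ ω, h (U (n + m) ω) ∂P = 0
    rw [← hmean, ← hlaw (n + m), integral_map (hU _).aemeasurable hh.aestronglyMeasurable]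
  · have hA' : MeasurableSet A := (inputFiltration hU hV).le (n + m) _ hA
    have h1 := lintegral_mul_eq_lintegral_mul_lintegral_of_independent_measurableSpace
      (μ := P) (f := fun ω => ENNReal.ofReal (h (U (n + m) ω) ^ 2)) (g := A.indicator 1)
      (hU (n + m)).comap_le ((inputFiltration hU hV).le (n + m))
      (indep_inputFiltration hU hV hiid hUV (n + m))
      ((hh.comp (comap_measurable (U (n + m)))).pow_const 2).ennreal_ofReal
      (Measurable.indicator (@measurable_one _ _ _ (inputFiltration hU hV (n + m)) _) hA)
    rw [setLIntegral_const, ← lintegral_indicator_one hA', ← hlaw (n + m),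
      lintegral_map (hh.pow_const 2).ennreal_ofReal (hU _), ← h1, ← lintegral_indicator hA']
    refine le_of_eq (lintegral_congr fun ω => ?_)
    by_cases hω : ω ∈ A <;> simp [hω]
  · have hfin : ∫⁻ x, ENNReal.ofReal (h x ^ 2) ∂μ ≠ ∞ := by
      rw [← ofReal_integral_eq_lintegral_ofReal hh2.integrable_sq
        (ae_of_all _ fun _ => sq_nonneg _)]
      exact ENNReal.ofReal_ne_top
    obtain ⟨M, hM⟩ := ENNReal.exists_nat_gt hfin
    exact ae_of_all _ fun ω => ⟨M, fun _ => hM.le⟩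

/-- Needed for products at equal times: for square integrable basis functions these are only
integrable, so the strong law is used instead of an L² martingale argument. -/
theorem ae_tendsto_average_input [IsProbabilityMeasure P] (hU : ∀ n, Measurable (U n))
    (hiid : iIndepFun U P) {μ : Measure ℝ} (hlaw : ∀ n, P.map (U n) = μ) {h : ℝ → ℝ}
    (hh : Measurable h) (hint : Integrable h μ) (m : ℕ) :
    ∀ᵐ ω ∂P, Tendsto (fun N : ℕ => (∑ n ∈ Finset.range N, h (U (n + m) ω)) / N) atTop
      (nhds (∫ x, h x ∂μ)) := by
  have hid : ∀ n n', IdentDistrib (U n) (U n') P P := fun n n' =>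
    ⟨(hU n).aemeasurable, (hU n').aemeasurable, by rw [hlaw, hlaw]⟩
  have h1 := strong_law_ae_real (μ := P) (fun n ω => h (U (n + m) ω)) (by
      have := hint
      rw [← hlaw (0 + m)] at this
      exact this.comp_measurable (hU _))
    (fun i j hij => (hiid.indepFun (i := i + m) (j := j + m) (by simpa using hij)).comp hh hh)
    (fun i => (hid (i + m) (0 + m)).comp hh)
  have e : ∫ ω, h (U (0 + m) ω) ∂P = ∫ x, h x ∂μ := by
    rw [← hlaw (0 + m), integral_map (hU _).aemeasurable hh.aestronglyMeasurable]
  rw [e] at h1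
  exact h1

end Input

/-! ### Positive definiteness of the input covariance -/

section Covariance

variable {s : ℕ} {μ : Measure ℝ} [IsProbabilityMeasure μ]

/-- The covariance matrix of the basis functions is positive definite. -/
theorem covariance_pos_of_basisIndependentOn {g : Fin s → ℝ → ℝ} {lo hi : ℝ}
    (hbasis : BasisIndependentOn g lo hi)
    (hac : (volume.restrict (Set.Icc lo hi)) ≪ μ)
    (hg2 : ∀ j, MemLp (g j) 2 μ) {c : Fin s → ℝ} (hc : c ≠ 0) :
    0 < ∑ j, ∑ j', c j * c j' *
      ∫ x, (g j x - ∫ t, g j t ∂μ) * (g j' x - ∫ t, g j' t ∂μ) ∂μ := by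
  set gc : Fin s → ℝ → ℝ := fun j x => g j x - ∫ t, g j t ∂μ with hgc
  have hgc2 : ∀ j, MemLp (gc j) 2 μ := fun j => (hg2 j).sub (memLp_const _)
  have hprod : ∀ j j', Integrable (fun x => gc j x * gc j' x) μ := fun j j' =>
    (hgc2 j).integrable_mul (hgc2 j')
  have e : ∑ j, ∑ j', c j * c j' * ∫ x, gc j x * gc j' x ∂μ =
      ∫ x, (∑ j, c j * gc j x) ^ 2 ∂μ := by
    have e1 : ∀ x, (∑ j, c j * gc j x) ^ 2 = ∑ j, ∑ j', c j * c j' * (gc j x * gc j' x) := by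
      intro x
      rw [pow_two, Finset.sum_mul_sum]
      exact Finset.sum_congr rfl fun _ _ => Finset.sum_congr rfl fun _ _ => by ring
    simp only [e1]
    rw [integral_finsetSum _ fun j _ =>
      integrable_finsetSum _ fun j' _ => (hprod j j').const_mul _]
    refine Finset.sum_congr rfl fun j _ => ?_
    rw [integral_finsetSum _ fun j' _ => (hprod j j').const_mul _]
    exact Finset.sum_congr rfl fun j' _ => (integral_const_mul _ _).symm
  change 0 < ∑ j, ∑ j', c j * c j' * ∫ x, gc j x * gc j' x ∂μ
  rw [e]
  have hL2 : MemLp (fun x => ∑ j, c j * gc j x) 2 μ :=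
    memLp_finsetSum _ fun j _ => (hgc2 j).const_mul _
  refine lt_of_le_of_ne (integral_nonneg fun _ => sq_nonneg _) fun h0 => hc ?_
  rw [eq_comm, integral_eq_zero_iff_of_nonneg (fun _ => sq_nonneg _) hL2.integrable_sq] at h0
  -- Zero variance is an affine relation among the `g_j`; the means supply the coefficient of the
  -- function 1.
  refine (hbasis (-∑ j, c j * ∫ t, g j t ∂μ) c (hac.ae_le ?_)).2
  filter_upwards [h0] with x hx
  have hx' : (∑ j, c j * gc j x) ^ 2 = 0 := hx
  have := pow_eq_zero_iff two_ne_zero |>.1 hx'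
  simp only [hgc, mul_sub, Finset.sum_sub_distrib] at this
  linarith

/-- Where the density is positive, a null set of the law is Lebesgue-null; this carries almost sure
relations under the input law over to the interval. -/
theorem restrict_absolutelyContinuous_withDensity {dens : ℝ → ℝ} (hd : Measurable dens) {A : Set ℝ}
    (hpos : ∀ x ∈ A, 0 < dens x) :
    volume.restrict A ≪ volume.withDensity fun x => ENNReal.ofReal (dens x) := by
  refine Measure.AbsolutelyContinuous.mk fun B hB h0 => ?_
  rw [withDensity_apply _ hB, lintegral_eq_zero_iff hd.ennreal_ofReal,
    Filter.EventuallyEq, ae_restrict_iff' hB] at h0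
  rw [Measure.restrict_apply hB]
  refine measure_mono_null (fun x hx => ?_) (ae_iff.1 h0)
  simpa using ⟨hx.1, hpos x hx.2⟩

end Covariance

/-! ### Excitation and growth along a Hammerstein path -/

section PathExcitation

variable {p q s : ℕ}

theorem eventually_le_of_tendsto_div {S : ℕ → ℝ} {r δ : ℝ}
    (h : Tendsto (fun N : ℕ => S N / N) atTop (nhds r)) (hδ : 0 < δ) :
    ∀ᶠ N : ℕ in atTop, (r - δ) * N ≤ S N := by
  filter_upwards [h.eventually_const_lt (show r - δ < r by linarith), eventually_gt_atTop 0]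
    with N hN hN0
  have hN0' : (0 : ℝ) < N := by exact_mod_cast hN0
  exact ((lt_div_iff₀ hN0').1 hN).le

theorem basisCoeff_apply (a : Fin p → ℝ) (b : Fin q → ℝ) (d : Fin s → ℝ) (m : ℕ) (j : Fin s)
    (x : Fin p ⊕ (Fin q × Fin s) → ℝ) :
    basisCoeff a b d m j x = (basisPoly a b d x j).coeff m := rfl

/-- Persistent excitation of the Hammerstein regressor along a sample path with the right
empirical second moments. -/
theorem IsHammersteinPath.exists_excitation {a : Fin p → ℝ} {b : Fin q → ℝ} {d : Fin s → ℝ}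
    {g : Fin s → ℝ → ℝ} {y u : ℤ → ℝ} {w : ℕ → ℝ} (h : IsHammersteinPath a b d g y u w)
    (gc : Fin s → ℝ → ℝ) (μ : Fin s → ℝ) (hgc : ∀ j t, g j t = gc j t + μ j)
    (Cov : Fin s → Fin s → ℝ) (κ : ℝ)
    (hww : ∀ i k, 2 ≤ i → i < k →
      Tendsto (fun N : ℕ => (∑ n ∈ Finset.range N, w (n + i) * w (n + k)) / N) atTop (nhds 0))
    (hw : ∀ i, 2 ≤ i →
      Tendsto (fun N : ℕ => (∑ n ∈ Finset.range N, w (n + i)) / N) atTop (nhds 0))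
    (hwu : ∀ i k j, 2 ≤ i → 1 ≤ k → Tendsto (fun N : ℕ =>
      (∑ n ∈ Finset.range N, w (n + i) * gc j (u ((n + k : ℕ) : ℤ))) / N) atTop (nhds 0))
    (huu : ∀ i k j j', 1 ≤ i → i < k → Tendsto (fun N : ℕ =>
      (∑ n ∈ Finset.range N, gc j (u ((n + i : ℕ) : ℤ)) * gc j' (u ((n + k : ℕ) : ℤ))) / N)
      atTop (nhds 0))
    (hu : ∀ k j, 1 ≤ k → Tendsto (fun N : ℕ =>
      (∑ n ∈ Finset.range N, gc j (u ((n + k : ℕ) : ℤ))) / N) atTop (nhds 0))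
    (hcov : ∀ k j j', 1 ≤ k → Tendsto (fun N : ℕ =>
      (∑ n ∈ Finset.range N, gc j (u ((n + k : ℕ) : ℤ)) * gc j' (u ((n + k : ℕ) : ℤ))) / N)
      atTop (nhds (Cov j j')))
    (hκ : ∀ i, 2 ≤ i → ∀ δ : ℝ, 0 < δ → ∀ᶠ N : ℕ in atTop,
      (κ - δ) * N ≤ ∑ n ∈ Finset.range N, w (n + i) ^ 2)
    (hpos : ∀ x, x ≠ 0 → 0 < κ * ∑ i, x (Sum.inl i) ^ 2 + ∑ m : Fin (p + q + 2), ∑ j, ∑ j',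
      basisCoeff a b d m j x * basisCoeff a b d m j' x * Cov j j') :
    ∃ c : ℝ, 0 < c ∧ ∀ᶠ N : ℕ in atTop, ∀ x : Fin p ⊕ (Fin q × Fin s) → ℝ,
      c * N * ∑ l, x l ^ 2 ≤
        ∑ k ∈ Finset.Icc 1 N, (x ⬝ᵥ hammersteinRegressor p q g y u k) ^ 2 := by
  classical
  set K : ℕ := p + q + 4 with hK
  refine exists_excitation_of_filtered (K := K) a (by omega) _ ?_
  -- Coordinates of the filtered direction: noise lags, centred basis functions at each lag, and one
  -- constant collecting the means. The choice of `K` keeps every time index `K - i`, `K - m` at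
  -- least 2.
  let L : (Fin p ⊕ (Fin q × Fin s) → ℝ) →ₗ[ℝ] (Fin p ⊕ (Fin (p + q + 2) × Fin s) ⊕ Unit → ℝ) :=
    LinearMap.pi (Sum.elim (fun i => LinearMap.proj (Sum.inl i))
      (Sum.elim (fun mj => basisCoeff a b d mj.1 mj.2)
        (fun _ => ∑ m : Fin (p + q + 2), ∑ j, μ j • basisCoeff a b d m j)))
  let η : Fin p ⊕ (Fin (p + q + 2) × Fin s) ⊕ Unit → ℕ → ℝ :=
    Sum.elim (fun i n => w (n + (K - i)))
      (Sum.elim (fun mj n => gc mj.2 (u ((n + (K - mj.1) : ℕ) : ℤ))) (fun _ _ => 1))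
  -- Block diagonal: `κ` for noise, the same covariance at each lag, 1 for the constant.
  let R : Fin p ⊕ (Fin (p + q + 2) × Fin s) ⊕ Unit →
      Fin p ⊕ (Fin (p + q + 2) × Fin s) ⊕ Unit → ℝ := fun
    | Sum.inl i, Sum.inl i' => if i = i' then κ else 0
    | Sum.inr (Sum.inl mj), Sum.inr (Sum.inl mj') => if mj.1 = mj'.1 then Cov mj.2 mj'.2 else 0
    | Sum.inr (Sum.inr _), Sum.inr (Sum.inr _) => 1
    | _, _ => 0
  have hv : ∀ x n, x ⬝ᵥ hammersteinRegressor p q g y u (n + K) - ∑ i : Fin p,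
      a i * (x ⬝ᵥ hammersteinRegressor p q g y u (n + K - (i + 1))) = ∑ c, L x c * η c n := by
    intro x n
    rw [h.filtered_dotProduct x (by omega)]
    simp only [Fintype.sum_sum_type, Fintype.sum_prod_type, L, η, LinearMap.pi_apply,
      Sum.elim_inl, Sum.elim_inr, LinearMap.proj_apply, LinearMap.sum_apply, LinearMap.smul_apply,
      Finset.univ_unique, Finset.sum_singleton, smul_eq_mul, basisCoeff_apply, mul_one,
      ← Finset.sum_add_distrib]
    congr 1
    · refine Finset.sum_congr rfl fun i _ => ?_
      have := i.2
      rw [show n + K - (i : ℕ) = n + (K - i) by omega]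
    · refine Finset.sum_congr rfl fun m _ => Finset.sum_congr rfl fun j _ => ?_
      have := m.2
      rw [show ((n + K : ℕ) : ℤ) - (m : ℕ) = ((n + (K - m) : ℕ) : ℤ) by omega, hgc]
      ring
  simp only [hv]
  refine exists_excitation_of_moments L η R (fun x hx => ?_) (fun c c' hcc => ?_)
    (fun c δ hδ => ?_)
  · have e : ∑ c, ∑ c', L x c * L x c' * R c c' = κ * ∑ i, x (Sum.inl i) ^ 2 +
        ∑ m : Fin (p + q + 2), ∑ j, ∑ j',
          basisCoeff a b d m j x * basisCoeff a b d m j' x * Cov j j' +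
        (L x (Sum.inr (Sum.inr ()))) ^ 2 := by
      simp only [Fintype.sum_sum_type, Fintype.sum_prod_type, R, mul_ite, mul_zero,
        Finset.sum_ite_eq, Finset.sum_const_zero, add_zero, zero_add, Finset.mem_univ, if_true,
        Finset.univ_unique, Finset.sum_singleton, mul_one, ← add_assoc]
      congr 1
      · congr 1
        · rw [Finset.mul_sum]
          refine Finset.sum_congr rfl fun i _ => ?_
          simp only [L, LinearMap.pi_apply, Sum.elim_inl, LinearMap.proj_apply]
          ring
        · refine Finset.sum_congr rfl fun m _ => Finset.sum_congr rfl fun j _ => ?_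
          rw [Finset.sum_comm]
          simp [L]
      · exact (pow_two _).symm
    rw [e]
    exact add_pos_of_pos_of_nonneg (hpos x hx) (sq_nonneg _)
  · rcases c with i | ⟨m, j⟩ | ⟨⟩ <;> rcases c' with i' | ⟨m', j'⟩ | ⟨⟩ <;>
      simp only [η, R, Sum.elim_inl, Sum.elim_inr, mul_one, one_mul]
    · have hne : i ≠ i' := fun e => hcc (by rw [e])
      have h1 := i.2
      have h2 := i'.2
      rw [if_neg hne]
      rcases lt_or_gt_of_ne (Fin.val_ne_of_ne hne) with hlt | hlt
      · simp only [mul_comm (w (_ + (K - (i : ℕ))))]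
        exact hww _ _ (by omega) (by omega)
      · exact hww _ _ (by omega) (by omega)
    · have h1 := i.2
      have h2 := m'.2
      exact hwu _ _ _ (by omega) (by omega)
    · have h1 := i.2
      exact hw _ (by omega)
    · have h1 := i'.2
      have h2 := m.2
      simp only [mul_comm (gc _ _)]
      exact hwu _ _ _ (by omega) (by omega)
    · have h1 := m.2
      have h2 := m'.2
      split_ifs with hm
      · subst hm
        exact hcov _ _ _ (by omega)
      · rcases lt_or_gt_of_ne (Fin.val_ne_of_ne hm) with hlt | hlt
        · simp only [mul_comm (gc j _)]
          exact huu _ _ _ _ (by omega) (by omega)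
        · exact huu _ _ _ _ (by omega) (by omega)
    · have h1 := m.2
      exact hu _ _ (by omega)
    · have h1 := i'.2
      exact hw _ (by omega)
    · have h1 := m'.2
      exact hu _ _ (by omega)
    · exact absurd rfl hcc
  · rcases c with i | ⟨m, j⟩ | ⟨⟩ <;> simp only [η, R, Sum.elim_inl, Sum.elim_inr, if_true]
    · have h1 := i.2
      exact hκ _ (by omega) δ hδ
    · have h1 := m.2
      simp only [pow_two]
      exact eventually_le_of_tendsto_div (hcov _ _ _ (by omega)) hδ
    · refine Eventually.of_forall fun N => ?_
      have : (0 : ℝ) ≤ N := Nat.cast_nonneg N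
      simp
      nlinarith

theorem eventually_le_sum_shift {w : ℕ → ℝ} {c : ℝ}
    (h : ∀ᶠ N : ℕ in atTop, c * N ≤ ∑ k ∈ Finset.Icc 1 N, w k ^ 2) (i : ℕ) {δ : ℝ} (hδ : 0 < δ) :
    ∀ᶠ N : ℕ in atTop, (c - δ) * N ≤ ∑ n ∈ Finset.range N, w (n + (i + 1)) ^ 2 := by
  filter_upwards [h, (tendsto_natCast_atTop_atTop (R := ℝ)).eventually_ge_atTop
    ((∑ k ∈ Finset.range (i + 1), w k ^ 2) / δ)] with N hN hN'
  rw [div_le_iff₀ hδ] at hN'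
  have h1 : ∑ k ∈ Finset.Icc 1 N, w k ^ 2 ≤ ∑ k ∈ Finset.range (i + 1 + N), w k ^ 2 := by
    refine Finset.sum_le_sum_of_subset_of_nonneg (fun k hk => ?_) fun _ _ _ => sq_nonneg _
    simp only [Finset.mem_Icc, Finset.mem_range] at hk ⊢
    omega
  rw [Finset.sum_range_add] at h1
  simp only [add_comm (i + 1)] at h1
  linarith

theorem sum_Icc_one_eq_sum_range (f : ℕ → ℝ) (N : ℕ) :
    ∑ k ∈ Finset.Icc 1 N, f k = ∑ n ∈ Finset.range N, f (n + 1) := by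
  rw [Finset.range_eq_Ico, Finset.sum_Ico_add']
  rfl

theorem weightedSqSummable_sub_iff (t : ℤ → ℝ) (m : ℕ) :
    WeightedSqSummable (fun n : ℕ => t ((n : ℤ) - m)) ↔ WeightedSqSummable fun n : ℕ => t n := by
  rw [← weightedSqSummable_nat_add_iff m]
  simp

/-- Stability keeps the regressor in the weighted square-summable class. -/
theorem IsHammersteinPath.weightedSqSummable_regressor {a : Fin p → ℝ} {b : Fin q → ℝ}
    {d : Fin s → ℝ} {g : Fin s → ℝ → ℝ} {y u : ℤ → ℝ} {w : ℕ → ℝ}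
    (h : IsHammersteinPath a b d g y u w) (hstable : StableARX a b) (hw : WeightedSqSummable w)
    (hu : ∀ j, WeightedSqSummable fun n : ℕ => g j (u n)) (l : Fin p ⊕ (Fin q × Fin s)) :
    WeightedSqSummable fun n : ℕ => hammersteinRegressor p q g y u (n + 1) l := by
  refine (weightedSqSummable_nat_add_iff
    (v := fun n => hammersteinRegressor p q g y u n l) 1).2 ?_
  rcases l with i | ⟨i, j⟩
  · refine (weightedSqSummable_sub_iff y i).2 ?_
    refine weightedSqSummable_of_aeval_backshift (arPoly a) hstable.1 y ?_
    -- The system equation starts at time 2; arbitrary earlier values do not affect summability.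
    refine (weightedSqSummable_congr_of_le 2 (v' := fun n : ℕ => ∑ j, d j *
      Polynomial.aeval (backshift ℝ) (Polynomial.X * inputPoly b) (fun k => g j (u k)) (n : ℤ) +
        w n) fun n hn => ?_).2 ?_
    · rw [h.aeval_arPoly (by omega), Int.toNat_natCast]
    · refine (weightedSqSummable_sum _ fun j _ => WeightedSqSummable.const_mul ?_ _).add hw
      simp only [aeval_backshift_apply (Nat.lt_succ_self _)]
      exact weightedSqSummable_sum _ fun m _ => WeightedSqSummable.const_mul
        ((weightedSqSummable_sub_iff (fun k => g j (u k)) m).2 (hu j)) _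
  · exact (weightedSqSummable_sub_iff (fun k => g j (u k)) i).2 (hu j)

theorem nextOutput_eq {a : Fin p → ℝ} {b : Fin q → ℝ} {d : Fin s → ℝ} {g : Fin s → ℝ → ℝ}
    {y u : ℤ → ℝ} {w : ℕ → ℝ} (h : IsHammersteinPath a b d g y u w) {k : ℕ} (hk : 1 ≤ k) :
    nextOutput y k = (Sum.elim a (fun ij => b ij.1 * d ij.2) : Fin p ⊕ (Fin q × Fin s) → ℝ) ⬝ᵥ
      hammersteinRegressor p q g y u k + w (k + 1) := by
  rw [nextOutput, h k hk]
  simp [dotProduct, Fintype.sum_sum_type, Fintype.sum_prod_type, hammersteinRegressor,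
    Finset.mul_sum, mul_assoc]

/-- If some `basisPoly` is nonzero, the covariance block at the lag of its leading coefficient is
positive. If all vanish, minimality gives `x = 0`, while for `κ > 0` a vanishing noise term leaves
only `A` times the input part, which again gives `x = 0`. -/
theorem limit_form_pos {a : Fin p → ℝ} {b : Fin q → ℝ} {d : Fin s → ℝ} {Cov : Fin s → Fin s → ℝ}
    (hCov : ∀ c : Fin s → ℝ, c ≠ 0 → 0 < ∑ j, ∑ j', c j * c j' * Cov j j') {κ : ℝ} (hκ : 0 ≤ κ)
    (hb : ∑ i, b i ^ 2 ≠ 0) (hmin : 0 < κ ∨ MinimalSystem a b d)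
    {x : Fin p ⊕ (Fin q × Fin s) → ℝ} (hx : x ≠ 0) :
    0 < κ * ∑ i, x (Sum.inl i) ^ 2 + ∑ m : Fin (p + q + 2), ∑ j, ∑ j',
      basisCoeff a b d m j x * basisCoeff a b d m j' x * Cov j j' := by
  have h0 : 0 ≤ ∑ i, x (Sum.inl i) ^ 2 := Finset.sum_nonneg fun _ _ => sq_nonneg _
  have hnn : ∀ m : Fin (p + q + 2), 0 ≤ ∑ j, ∑ j',
      basisCoeff a b d m j x * basisCoeff a b d m j' x * Cov j j' := fun m => by
    by_cases hm : (fun j => basisCoeff a b d m j x) = 0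
    · have : ∀ j, basisCoeff a b d m j x = 0 := fun j => congrFun hm j
      simp [this]
    · exact (hCov _ hm).le
  by_cases hall : ∀ j, basisPoly a b d x j = 0
  · rcases hmin with hκ0 | hmin
    · refine add_pos_of_pos_of_nonneg (mul_pos hκ0 ?_) (Finset.sum_nonneg fun m _ => hnn m)
      by_contra hle
      have h1 : ∑ i, x (Sum.inl i) ^ 2 = 0 := le_antisymm (not_lt.1 hle) h0
      rw [Finset.sum_eq_zero_iff_of_nonneg fun _ _ => sq_nonneg _] at h1
      exact hx (eq_zero_of_basisPoly_eq_zero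
        (fun i => pow_eq_zero_iff two_ne_zero |>.1 (h1 i (Finset.mem_univ i))) hall)
    · exact absurd (hmin.eq_zero_of_basisPoly_eq_zero hb hall) hx
  · push Not at hall
    obtain ⟨j, hj⟩ := hall
    refine add_pos_of_nonneg_of_pos (mul_nonneg hκ h0) (Finset.sum_pos' (fun m _ => hnn m)
      ⟨⟨(basisPoly a b d x j).natDegree, natDegree_basisPoly_lt a b d x j⟩, Finset.mem_univ _, ?_⟩)
    refine hCov (fun j' => basisCoeff a b d (basisPoly a b d x j).natDegree j' x) fun h1 => hj ?_
    have h2 := congrFun h1 j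
    simp only [basisCoeff_apply, Pi.zero_apply, Polynomial.coeff_natDegree] at h2
    exact Polynomial.leadingCoeff_eq_zero.1 h2

end PathExcitation

/-! ### Almost sure estimates and conclusion -/

theorem proposition2 {Ω : Type*} {mΩ : MeasurableSpace Ω} (P : Measure Ω) [IsProbabilityMeasure P]
    {p q s : ℕ} (a : Fin p → ℝ) (b : Fin q → ℝ) (d : Fin s → ℝ)
    (g : Fin s → ℝ → ℝ) (hg : ∀ j, Measurable (g j))
    (lo hi : ℝ) (hlohi : lo < hi)
    (y u : ℤ → Ω → ℝ) (w : ℕ → Ω → ℝ) (ℱ : Filtration ℕ mΩ)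
    (hadapted : ∀ k : ℕ, 1 ≤ k → ∀ j : ℤ, j ≤ k → Measurable[ℱ k] (y j) ∧ Measurable[ℱ k] (u j))
    (hsystem : ∀ ω, IsHammersteinPath a b d g (fun j => y j ω) (fun j => u j ω) (fun k => w k ω))
    (hnoise : MartingaleDifferenceNoise P ℱ w)
    (hstable : StableARX a b)
    (hbasis : BasisIndependentOn g lo hi)
    (hinput : IIDInput P g lo hi u w)
    (hnondeg : PersistentNoise P w ∨ MinimalSystem a b d)
    (ε : ℝ) (hε : ε ∈ Set.Ioo (0 : ℝ) (1 / 2)) :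
    ∀ᵐ ω ∂P, ∃ N₀ : ℕ, ∀ N : ℕ, N₀ ≤ N →
      SparseAlgorithmWellDefined
          (hammersteinRegressor p q g (fun j => y j ω) (fun j => u j ω))
          (nextOutput fun j => y j ω) (fun n => (n : ℝ) ^ (1 / 2 + ε)) N ∧
      ∀ β : Fin p ⊕ (Fin q × Fin s) → ℝ,
        IsSparseEstimate
          (hammersteinRegressor p q g (fun j => y j ω) (fun j => u j ω))
          (nextOutput fun j => y j ω) (fun n => (n : ℝ) ^ (1 / 2 + ε)) N β →
        zeroColumns β = {l | d l = 0} := by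
  obtain ⟨hiid, ⟨dens, hdm, -, -, hdpos, hdlaw⟩, hgsq, hUV⟩ := hinput
  -- Both sequences are shifted so that index 0 is time 1, where the assumptions begin.
  set U : ℕ → Ω → ℝ := fun k ω => u ((k : ℤ) + 1) ω with hUdef
  set V : Ω → ℕ → ℝ := fun ω k => w (k + 1) ω with hVdef
  have hU : ∀ n, Measurable (U n) := fun n =>
    (hadapted (n + 1) (by omega) ((n : ℤ) + 1) (by push_cast; omega)).2.mono (ℱ.le _) le_rfl
  have hV : Measurable V := measurable_pi_iff.2 fun k =>
    (hnoise.1 (k + 1) (by omega)).mono (ℱ.le _) le_rfl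
  set μ : Measure ℝ := volume.withDensity fun x => ENNReal.ofReal (dens x) with hμ
  have hlaw : ∀ n, P.map (U n) = μ := fun n => hdlaw _ (by omega)
  have hprob : IsProbabilityMeasure μ := by
    rw [← hlaw 0]; exact Measure.isProbabilityMeasure_map (hU 0).aemeasurable
  have hg2 : ∀ j, MemLp (g j) 2 μ := fun j => by
    rw [memLp_two_iff_integrable_sq (hg j).aestronglyMeasurable, ← hlaw 0,
      integrable_map_measure ((hg j).pow_const 2).aestronglyMeasurable (hU 0).aemeasurable]
    exact (hgsq j ((0 : ℕ) + 1) (by norm_num)).1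
  set gc : Fin s → ℝ → ℝ := fun j x => g j x - ∫ t, g j t ∂μ with hgc
  have hgcm : ∀ j, Measurable (gc j) := fun j => (hg j).sub_const _
  have hgc2 : ∀ j, MemLp (gc j) 2 μ := fun j => (hg2 j).sub (memLp_const _)
  have hgc0 : ∀ j, ∫ x, gc j x ∂μ = 0 := fun j => by
    rw [hgc]; dsimp only
    rw [integral_sub ((hg2 j).integrable one_le_two) (integrable_const _)]
    simp
  set Cov : Fin s → Fin s → ℝ := fun j j' => ∫ x, gc j x * gc j' x ∂μ with hCov
  have hCovpos : ∀ c : Fin s → ℝ, c ≠ 0 → 0 < ∑ j, ∑ j', c j * c j' * Cov j j' := fun c hc =>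
    covariance_pos_of_basisIndependentOn hbasis
      (restrict_absolutelyContinuous_withDensity hdm hdpos) hg2 hc
  have hin := fun j m => isBoundedVarianceMDS_input hU hV hiid hUV hlaw (hgcm j) (hgc2 j)
    (hgc0 j) m
  have hWw : ∀ᵐ ω ∂P, WeightedSqSummable fun n => w n ω := by
    obtain ⟨σ, hσ⟩ := hnoise.exists_isBoundedVarianceMDS le_rfl
    filter_upwards [hσ.ae_weightedSqSummable] with ω hω
    exact (weightedSqSummable_nat_add_iff (v := fun n => w n ω) 2).1 hω
  have hWu : ∀ᵐ ω ∂P, ∀ j, WeightedSqSummable fun n => gc j (U n ω) :=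
    ae_all_iff.2 fun j => (hin j 0).ae_weightedSqSummable
  -- The later noise value is the martingale difference; `i ≤ m` makes the earlier one predictable.
  have hww : ∀ᵐ ω ∂P, ∀ i m : ℕ, 2 ≤ i → i ≤ m → WeightedSqSummable (fun n => w (n + i) ω) →
      ∃ C : ℝ, ∀ N : ℕ, |∑ n ∈ Finset.range N, w (n + i) ω * w (n + m + 1) ω| ≤
        C * (N : ℝ) ^ (9 / 16 : ℝ) := by
    refine ae_all_iff.2 fun i => ae_all_iff.2 fun m => ?_
    by_cases him : 2 ≤ i ∧ i ≤ m
    · obtain ⟨σ, hσ⟩ := hnoise.exists_isBoundedVarianceMDS (m := m) (by omega)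
      filter_upwards [hσ.ae_abs_sum_le (a := fun n => w (n + i)) fun n =>
        (hnoise.1 (n + i) (by omega)).mono (ℱ.mono (by omega)) le_rfl] with ω hω _ _ using hω
    · exact ae_of_all _ fun ω h1 h2 => absurd ⟨h1, h2⟩ him
  have hw1 : ∀ᵐ ω ∂P, ∀ m : ℕ, 1 ≤ m → ∃ C : ℝ, ∀ N : ℕ,
      |∑ n ∈ Finset.range N, 1 * w (n + m + 1) ω| ≤ C * (N : ℝ) ^ (9 / 16 : ℝ) := by
    refine ae_all_iff.2 fun m => ?_
    by_cases hm : 1 ≤ m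
    · obtain ⟨σ, hσ⟩ := hnoise.exists_isBoundedVarianceMDS hm
      filter_upwards [hσ.ae_abs_sum_le (a := fun _ _ => 1) fun n => measurable_const]
        with ω hω _ using hω (weightedSqSummable_const 1)
    · exact ae_of_all _ fun ω h1 => absurd h1 hm
  -- Here the input is the martingale difference and the noise the predictable factor, so no order
  -- between the two times is needed.
  have hwu : ∀ᵐ ω ∂P, ∀ (i m : ℕ) (j : Fin s), WeightedSqSummable (fun n => w (n + i + 1) ω) →
      ∃ C : ℝ, ∀ N : ℕ, |∑ n ∈ Finset.range N, w (n + i + 1) ω * gc j (U (n + m) ω)| ≤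
        C * (N : ℝ) ^ (9 / 16 : ℝ) := by
    refine ae_all_iff.2 fun i => ae_all_iff.2 fun m => ae_all_iff.2 fun j => ?_
    exact (hin j m).ae_abs_sum_le (a := fun n => w (n + i + 1)) fun n =>
      measurable_inputFiltration_aux hU hV (n + i) (n + m)
  have huu : ∀ᵐ ω ∂P, ∀ (i m : ℕ) (j j' : Fin s), i < m →
      WeightedSqSummable (fun n => gc j (U (n + i) ω)) → ∃ C : ℝ, ∀ N : ℕ,
        |∑ n ∈ Finset.range N, gc j (U (n + i) ω) * gc j' (U (n + m) ω)| ≤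
          C * (N : ℝ) ^ (9 / 16 : ℝ) := by
    refine ae_all_iff.2 fun i => ae_all_iff.2 fun m => ae_all_iff.2 fun j =>
      ae_all_iff.2 fun j' => ?_
    by_cases him : i < m
    · filter_upwards [(hin j' m).ae_abs_sum_le (a := fun n ω => gc j (U (n + i) ω)) fun n =>
        (hgcm j).comp (measurable_inputFiltration_input hU hV (by omega))] with ω hω _ using hω
    · exact ae_of_all _ fun ω h1 => absurd h1 him
  have hu1 : ∀ᵐ ω ∂P, ∀ (m : ℕ) (j : Fin s), ∃ C : ℝ, ∀ N : ℕ,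
      |∑ n ∈ Finset.range N, 1 * gc j (U (n + m) ω)| ≤ C * (N : ℝ) ^ (9 / 16 : ℝ) := by
    refine ae_all_iff.2 fun m => ae_all_iff.2 fun j => ?_
    filter_upwards [(hin j m).ae_abs_sum_le (a := fun _ _ => 1) fun n => measurable_const]
      with ω hω using hω (weightedSqSummable_const 1)
  have hcov : ∀ᵐ ω ∂P, ∀ (m : ℕ) (j j' : Fin s), Tendsto (fun N : ℕ =>
      (∑ n ∈ Finset.range N, gc j (U (n + m) ω) * gc j' (U (n + m) ω)) / N) atTop
        (nhds (Cov j j')) := by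
    refine ae_all_iff.2 fun m => ae_all_iff.2 fun j => ae_all_iff.2 fun j' => ?_
    exact ae_tendsto_average_input hU hiid hlaw (h := fun x => gc j x * gc j' x)
      ((hgcm j).mul (hgcm j')) ((hgc2 j).integrable_mul (hgc2 j')) m
  have hφw : ∀ᵐ ω ∂P, ∀ l, WeightedSqSummable (fun n : ℕ =>
      hammersteinRegressor p q g (fun j => y j ω) (fun j => u j ω) (n + 1) l) → ∃ C : ℝ, ∀ N : ℕ,
        |∑ n ∈ Finset.range N, hammersteinRegressor p q g (fun j => y j ω) (fun j => u j ω)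
          (n + 1) l * w (n + 1 + 1) ω| ≤ C * (N : ℝ) ^ (9 / 16 : ℝ) := by
    refine ae_all_iff.2 fun l => ?_
    obtain ⟨σ, hσ⟩ := hnoise.exists_isBoundedVarianceMDS le_rfl
    refine hσ.ae_abs_sum_le (a := fun n ω =>
      hammersteinRegressor p q g (fun j => y j ω) (fun j => u j ω) (n + 1) l) fun n => ?_
    rcases l with i | ⟨i, j⟩
    · exact (hadapted (n + 1) (by omega) _ (by omega)).1
    · exact (hg j).comp (hadapted (n + 1) (by omega) _ (by omega)).2
  -- The noise level `κ` may depend on the path; it is 0 in the minimal case, where the inputs alone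
  -- excite all directions.
  have hκ : ∀ᵐ ω ∂P, ∃ κ : ℝ, 0 ≤ κ ∧ (0 < κ ∨ MinimalSystem a b d) ∧
      ∀ᶠ N : ℕ in atTop, κ * N ≤ ∑ k ∈ Finset.Icc 1 N, w k ω ^ 2 := by
    rcases hnondeg with hp | hmin
    · filter_upwards [hp] with ω ⟨c, hc, hev⟩ using ⟨c, hc.le, Or.inl hc, hev⟩
    · exact ae_of_all _ fun ω => ⟨0, le_rfl, Or.inr hmin, Eventually.of_forall fun N => by
        rw [zero_mul]; exact Finset.sum_nonneg fun _ _ => sq_nonneg _⟩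
  filter_upwards [hWw, hWu, hww, hw1, hwu, huu, hu1, hcov, hφw, hκ] with ω hWw hWu hww hw1 hwu huu
    hu1 hcov hφw ⟨κ, hκ0, hκmin, hκ⟩
  have hpath := hsystem ω
  have hWw' : ∀ i, WeightedSqSummable fun n => w (n + i) ω := fun i =>
    (weightedSqSummable_nat_add_iff (v := fun n => w n ω) i).2 hWw
  have hWu' : ∀ i j, WeightedSqSummable fun n => gc j (U (n + i) ω) := fun i j =>
    (weightedSqSummable_nat_add_iff (v := fun n => gc j (U n ω)) i).2 (hWu j)
  have hUu : ∀ n m : ℕ, u ((n + (m + 1) : ℕ) : ℤ) ω = U (n + m) ω := fun n m => by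
    simp only [hUdef]
    congr 1
  have hlow := hpath.exists_excitation gc (fun j => ∫ t, g j t ∂μ) (fun j t => by simp [hgc]) Cov κ
    (fun i k hi hik => by
      obtain ⟨m, rfl⟩ : ∃ m, k = m + 1 := ⟨k - 1, by omega⟩
      obtain ⟨C, hC⟩ := hww i m hi (by omega) (hWw' i)
      exact tendsto_div_of_abs_le_rpow hC)
    (fun i hi => by
      obtain ⟨m, rfl⟩ : ∃ m, i = m + 1 := ⟨i - 1, by omega⟩
      obtain ⟨C, hC⟩ := hw1 m (by omega)
      simp only [one_mul] at hC
      exact tendsto_div_of_abs_le_rpow hC)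
    (fun i k j hi hk => by
      obtain ⟨m, rfl⟩ : ∃ m, k = m + 1 := ⟨k - 1, by omega⟩
      obtain ⟨i, rfl⟩ : ∃ i', i = i' + 1 := ⟨i - 1, by omega⟩
      obtain ⟨C, hC⟩ := hwu i m j (hWw' (i + 1))
      simp only [hUu]
      exact tendsto_div_of_abs_le_rpow hC)
    (fun i k j j' hi hik => by
      obtain ⟨m, rfl⟩ : ∃ m, k = m + 1 := ⟨k - 1, by omega⟩
      obtain ⟨i, rfl⟩ : ∃ i', i = i' + 1 := ⟨i - 1, by omega⟩
      obtain ⟨C, hC⟩ := huu i m j j' (by omega) (hWu' i j)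
      simp only [hUu]
      exact tendsto_div_of_abs_le_rpow hC)
    (fun k j hk => by
      obtain ⟨m, rfl⟩ : ∃ m, k = m + 1 := ⟨k - 1, by omega⟩
      obtain ⟨C, hC⟩ := hu1 m j
      simp only [one_mul] at hC
      simp only [hUu]
      exact tendsto_div_of_abs_le_rpow hC)
    (fun k j j' hk => by
      obtain ⟨m, rfl⟩ : ∃ m, k = m + 1 := ⟨k - 1, by omega⟩
      simp only [hUu]
      exact hcov m j j')
    (fun i hi δ hδ => by
      obtain ⟨m, rfl⟩ : ∃ m, i = m + 1 := ⟨i - 1, by omega⟩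
      exact eventually_le_sum_shift hκ m hδ)
    (fun x hx => limit_form_pos hCovpos hκ0 hstable.2 hκmin hx)
  -- Constants belong to the weighted class, so the means can be added back.
  have hWg : ∀ j, WeightedSqSummable fun n : ℕ => g j (u n ω) := fun j => by
    refine (weightedSqSummable_nat_add_iff (v := fun n : ℕ => g j (u n ω)) 1).1 ?_
    have := (hWu j).add (weightedSqSummable_const (∫ t, g j t ∂μ))
    simpa [hgc, hUdef] using this
  have hWφ := hpath.weightedSqSummable_regressor hstable hWw hWg
  have hev := eventually_sparseEstimate_eq_zero_iff
    (hammersteinRegressor p q g (fun j => y j ω) (fun j => u j ω)) (nextOutput fun j => y j ω)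
    (fun k => w (k + 1) ω) (Sum.elim a fun ij => b ij.1 * d ij.2) hε
    (fun k hk => nextOutput_eq hpath hk) hlow (by
      choose C _ hC using fun l => (hWφ l).exists_sum_sq_le
      refine ⟨∑ l, C l, fun N => ?_⟩
      rw [sum_Icc_one_eq_sum_range, Finset.sum_comm, Finset.sum_mul]
      exact Finset.sum_le_sum fun l _ => hC l N) (fun l => by
      obtain ⟨C, hC⟩ := hφw l (hWφ l)
      refine ⟨C, fun N => ?_⟩
      rw [sum_Icc_one_eq_sum_range]
      exact hC N)
  obtain ⟨N₀, hN₀⟩ := eventually_atTop.1 hev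
  refine ⟨N₀, fun N hN => ⟨(hN₀ N hN).1, fun β hβ => ?_⟩⟩
  have hzero := (hN₀ N hN).2 β hβ
  -- One nonzero `b i` makes the column of products `b i * d l` vanish exactly when `d l = 0`.
  obtain ⟨i, hi⟩ : ∃ i, b i ≠ 0 := by
    by_contra hall
    push Not at hall
    exact hstable.2 (by simp [hall])
  ext l
  simp only [zeroColumns, Set.mem_ofPred_eq, hzero, Sum.elim_inr, mul_eq_zero]
  exact ⟨fun h => (h i).resolve_left hi, fun h _ => Or.inr h⟩
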